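/- Let $0<\mu<2$. For odd $n\ge1$ consider the $n\times n$ square lattice with periodic boundary conditions, with sites $\vec x\in(\mathbf Z/n)^2$, fermionic creation and annihilation operators $c_{\vec x}^\dagger,c_{\vec x}$, and the Hamiltonian of the (gapped, topological) chiral $p+ip$ superconductor $$H=\sum_{\vec x}\left(c_{\vec x+\vec i}^\dagger c_{\vec x}+c_{\vec x+\vec j}^\dagger c_{\vec x}+c_{\vec x+\vec i}^\dagger c_{\vec x}^\dagger+i\,c_{\vec x+\vec j}^\dagger c_{\vec x}^\dagger+\mathrm{h.c.}\right)-2\mu\sum_{\vec x}c_{\vec x}^\dagger c_{\vec x},\qquad \vec i=(1,0),\ \vec j=(0,1).$$ A fermionic neural network has one visible unit at each site and finitely many hidden units placed at sites; each unit $j$ carries a Grassmann number $\xi_j$, each pair of units a weight $w_{jk}\in\mathbf C$, and units $j,k$ are connected if $w_{jk}\ne0$. Its state is $$\phi=\frac1Z\left(\int\prod_{h\ \mathrm{hidden}}\mathrm d\xi_h\; e^{-\sum_{j,k}w_{jk}\xi_j\xi_k}\right)|0\rangle ,$$ where $\int$ is the Grassmann (Berezin) integral, the remaining visible Grassmann numbers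 $\xi_{\vec x}$ are replaced by $c_{\vec x}^\dagger$, $|0\rangle$ is the vacuum, and $Z$ normalizes the state. Then there is a constant $C$, depending only on $\mu$, such that for every odd $n\ge 1$ the Hamiltonian $H$ has a unique normalized ground state $\psi$ up to a scalar, and there is a fermionic neural network with well-defined state $\phi$, $\|\phi\|=1$, such that 1. $|\langle\phi|\psi\rangle|\ge1-C/n$; 2. any two connected units are at distance at most $C\log n$ in the shortest-path metric of the torus; 3. every site but one carries exactly one hidden unit, and the remaining site carries none; 4. there are no connections between visible units, and the weights are translation invariant: $w_{jk}$ depends only on the kinds (visible or hidden) of the units $j$ and $k$ and on the displacement between their sites. -/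

import Mathlib

open scoped InnerProductSpace

noncomputable section

namespace PWave

/-! ### Fermionic Fock space -/

section FockSpace

variable {V : Type*} [Fintype V] [DecidableEq V]

variable (V) in
/-- The fermionic Fock space of the modes `V`, in the occupation-number basis: the basis vector
`|A⟩`, for `A` a set of modes, is the state in which exactly the modes in `A` are occupied. -/
abbrev Fock : Type _ := EuclideanSpace ℂ (Finset V)

/-- The state without particles. -/
def vacuum : Fock V := EuclideanSpace.single ∅ 1

/-- The fermionic sign `(-1)^(number of modes in A that precede x)`, for a fixed enumeration of
the modes. -/
def fermionSign (A : Finset V) (x : V) : ℂ :=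
  (-1) ^ (A.filter fun y => Fintype.equivFin V y < Fintype.equivFin V x).card

/-- The creation operator `c_x†`. It sends `|A⟩` to `± |A ∪ {x}⟩` if `x ∉ A` and to `0`
otherwise; if `x₁, …, x_r` are the elements of `A` in increasing order, then
`|A⟩ = c_{x₁}† ⋯ c_{x_r}† |∅⟩`. -/
def create (x : V) : Module.End ℂ (Fock V) where
  toFun ψ := WithLp.toLp 2 fun A => if x ∈ A then fermionSign A x * ψ (A.erase x) else 0
  map_add' ψ φ := by
    ext A
    by_cases h : x ∈ A <;> simp [h, mul_add]
  map_smul' a ψ := by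
    ext A
    by_cases h : x ∈ A <;> simp [h, mul_left_comm]

/-- The annihilation operator `c_x`, the adjoint of `c_x†`. -/
def annihilate (x : V) : Module.End ℂ (Fock V) := LinearMap.adjoint (create x)

theorem create_apply (x : V) (ψ : Fock V) (A : Finset V) :
    create x ψ A = if x ∈ A then fermionSign A x * ψ (A.erase x) else 0 := rfl

theorem fermionSign_erase_of_lt {A : Finset V} {x y : V} (hx : x ∈ A)
    (h : Fintype.equivFin V x < Fintype.equivFin V y) :
    fermionSign (A.erase x) y = -fermionSign A y := by
  unfold fermionSign
  rw [Finset.filter_erase]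
  have hm : x ∈ A.filter fun z => Fintype.equivFin V z < Fintype.equivFin V y := by
    simp [hx, h]
  rw [← Finset.card_erase_add_one hm, pow_succ]
  ring

theorem fermionSign_erase_of_not_lt {A : Finset V} {x y : V}
    (h : ¬ Fintype.equivFin V x < Fintype.equivFin V y) :
    fermionSign (A.erase x) y = fermionSign A y := by
  unfold fermionSign
  rw [Finset.filter_erase, Finset.erase_eq_of_notMem (by simp [h])]

/-- The creation operators anticommute. -/
theorem create_mul_create (x y : V) : create x * create y = -(create y * create x) := by
  ext1 ψ
  ext A
  simp only [Module.End.mul_apply, LinearMap.neg_apply, PiLp.neg_apply, create_apply,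
    Finset.mem_erase]
  by_cases hxy : x = y
  · subst hxy; simp
  by_cases hx : x ∈ A <;> by_cases hy : y ∈ A <;> simp [hx, hy, hxy, Ne.symm hxy]
  rw [Finset.erase_right_comm]
  have hne : Fintype.equivFin V x ≠ Fintype.equivFin V y := by simpa using hxy
  rcases lt_or_gt_of_ne hne with h | h
  · rw [fermionSign_erase_of_lt hx h, fermionSign_erase_of_not_lt (not_lt.2 h.le)]
    ring
  · rw [fermionSign_erase_of_lt hy h, fermionSign_erase_of_not_lt (not_lt.2 h.le)]
    ring

/-- `ψ` is a normalized ground state of `H`: a unit eigenvector for the smallest eigenvalue. -/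
def IsGroundState (H : Module.End ℂ (Fock V)) (ψ : Fock V) : Prop :=
  ‖ψ‖ = 1 ∧ ∃ E : ℝ, H ψ = (E : ℂ) • ψ ∧ ∀ E' : ℝ, Module.End.HasEigenvalue H (E' : ℂ) → E ≤ E'

end FockSpace

/-! ### The `p + ip` superconductor on a torus -/

/-- The sites of the `n × n` square lattice with periodic boundary conditions. -/
abbrev Site (n : ℕ) : Type := ZMod n × ZMod n

/-- The shortest-path distance on the `n × n` torus. -/
def torusDist {n : ℕ} (x y : Site n) : ℕ :=
  (x.1 - y.1).valMinAbs.natAbs + (x.2 - y.2).valMinAbs.natAbs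

/-- The terms `c†_{x+i} c_x + c†_{x+j} c_x + c†_{x+i} c†_x + i c†_{x+j} c†_x`, summed over all
sites `x`. -/
def hoppingPairing (n : ℕ) [NeZero n] : Module.End ℂ (Fock (Site n)) :=
  ∑ x : Site n,
    (create (x + (1, 0)) * annihilate x + create (x + (0, 1)) * annihilate x
      + create (x + (1, 0)) * create x + Complex.I • (create (x + (0, 1)) * create x))

/-- The Hamiltonian of the `p + ip` superconductor on the `n × n` torus. -/
def hamiltonian (n : ℕ) [NeZero n] (μ : ℝ) : Module.End ℂ (Fock (Site n)) :=
  hoppingPairing n + LinearMap.adjoint (hoppingPairing n)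
    - (2 * μ : ℂ) • ∑ x : Site n, create x * annihilate x

/-! ### Fermionic neural network states -/

/-- A fermionic neural network on the `n × n` torus: every site carries one visible unit, and
there are finitely many hidden units, each placed at a site. The weights connect the units. -/
structure FermionicNetwork (n : ℕ) where
  /-- the number of hidden units -/
  numHidden : ℕ
  /-- the site at which a hidden unit is placed -/
  hiddenPos : Fin numHidden → Site n
  /-- the weights `w_{jk}` -/
  weight : Site n ⊕ Fin numHidden → Site n ⊕ Fin numHidden → ℂ

namespace FermionicNetwork

variable {n : ℕ} (N : FermionicNetwork n)

/-- The units: the visible ones are `Sum.inl x`, the hidden ones are `Sum.inr h`. -/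
abbrev Neuron : Type := Site n ⊕ Fin N.numHidden

/-- The site at which a unit is placed. -/
def pos : N.Neuron → Site n := Sum.elim id N.hiddenPos

/-- The Grassmann algebra with one generator for each unit. -/
abbrev Grassmann : Type := ExteriorAlgebra ℂ (N.Neuron → ℂ)

/-- The Grassmann number `ξ_j` of the unit `j`. -/
def xi (j : N.Neuron) : N.Grassmann := ExteriorAlgebra.ι ℂ (Pi.single j 1)

/-- The Berezin integral `∫ dξ_j` over one Grassmann number: the linear map with
`∫ dξ_j (ξ_j f) = f` and `∫ dξ_j f = 0` if `f` does not contain `ξ_j`. -/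
def berezin (j : N.Neuron) : N.Grassmann →ₗ[ℂ] N.Grassmann :=
  CliffordAlgebra.contractLeft (LinearMap.proj j)

/-- The iterated Berezin integral `∫ dξ_1 dξ_2 ⋯` over all hidden units. -/
def integrateHidden (f : N.Grassmann) : N.Grassmann :=
  (List.finRange N.numHidden).foldr (fun h g => N.berezin (Sum.inr h) g) f

variable [NeZero n]

/-- `∑_{j,k} w_{jk} ξ_j ξ_k`. -/
def energy : N.Grassmann := ∑ j : N.Neuron, ∑ k : N.Neuron, N.weight j k • (N.xi j * N.xi k)

/-- The linear map that sends `ξ_x` to `c_x†` for a visible unit `x`, and `ξ_h` to `0` for a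
hidden unit `h`. -/
def substLinear : (N.Neuron → ℂ) →ₗ[ℂ] Module.End ℂ (Fock (Site n)) :=
  ∑ x : Site n, (LinearMap.proj (Sum.inl x : N.Neuron)).smulRight (create x)

theorem substLinear_mul_self (v : N.Neuron → ℂ) : N.substLinear v * N.substLinear v = 0 := by
  have h : N.substLinear v * N.substLinear v = -(N.substLinear v * N.substLinear v) := by
    conv_lhs =>
      simp only [substLinear, LinearMap.sum_apply, LinearMap.smulRight_apply, LinearMap.proj_apply,
        Finset.sum_mul_sum, smul_mul_smul_comm]
    rw [Finset.sum_comm]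
    simp only [substLinear, LinearMap.sum_apply, LinearMap.smulRight_apply, LinearMap.proj_apply,
        Finset.sum_mul_sum, smul_mul_smul_comm, ← Finset.sum_neg_distrib]
    refine Finset.sum_congr rfl fun x _ => Finset.sum_congr rfl fun y _ => ?_
    rw [create_mul_create, smul_neg, mul_comm]
  rw [eq_neg_iff_add_eq_zero, ← two_smul ℂ] at h
  exact (smul_eq_zero.1 h).resolve_left two_ne_zero

/-- The substitution `p(ξ) ↦ p(c†)` of the creation operators for the visible Grassmann numbers.
It is only applied to polynomials without hidden Grassmann numbers. -/
def subst : N.Grassmann →ₐ[ℂ] Module.End ℂ (Fock (Site n)) :=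
  ExteriorAlgebra.lift ℂ ⟨N.substLinear, N.substLinear_mul_self⟩

/-- The unnormalized state `(∫ dξ_1 dξ_2 ⋯ exp(-∑_{j,k} w_{jk} ξ_j ξ_k)) |0⟩`, where the integral
is over the hidden units. -/
def unnormalizedState : Fock (Site n) :=
  N.subst (N.integrateHidden (IsNilpotent.exp (-N.energy))) vacuum

/-- The fermionic neural network state: the unnormalized state divided by its norm. -/
def state : Fock (Site n) := ((‖N.unnormalizedState‖ : ℂ)⁻¹) • N.unnormalizedState

end FermionicNetwork

end PWave

end

noncomputable section

namespace PWave

/-! ### Nilpotent exponentials of quadratic expressions -/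

section Exponential

variable {A : Type*} [Ring A]

/-- A derivation-like map passes through a nilpotent exponential as the chain rule predicts. -/
theorem map_exp_mul [Algebra ℚ A] {a b : A} (hab : Commute a b) (ha : IsNilpotent a) (D : A →+ A)
    (hD : ∀ y, D (a * y) = b * y + a * D y) (y : A) :
    D (IsNilpotent.exp a * y) = b * (IsNilpotent.exp a * y) + IsNilpotent.exp a * D y := by
  have hpow : ∀ (k : ℕ) (y : A),
      D (a ^ (k + 1) * y) = (k + 1 : ℚ) • (b * (a ^ k * y)) + a ^ (k + 1) * D y := by
    intro k
    induction k with
    | zero => simp [hD]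
    | succ k ih =>
      intro y
      have h1 : a * (b * (a ^ k * y)) = b * (a ^ (k + 1) * y) := by
        rw [← mul_assoc, hab.eq, pow_succ', mul_assoc, mul_assoc]
      rw [pow_succ', mul_assoc, hD, ih, mul_add, mul_smul_comm, h1, ← mul_assoc a]
      push_cast
      module
  obtain ⟨m, hm⟩ := ha
  have hm1 : a ^ (m + 1) = 0 := by rw [pow_succ, hm, zero_mul]
  have hrat : ∀ (q : ℚ) (x : A), D (q • x) = q • D x := fun q x => map_rat_smul D q x
  have h2 : b * (IsNilpotent.exp a * y)
      = ∑ k ∈ Finset.range m, (k.factorial : ℚ)⁻¹ • (b * (a ^ k * y)) := by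
    rw [IsNilpotent.exp_eq_sum hm, Finset.sum_mul, Finset.mul_sum]
    simp only [smul_mul_assoc, mul_smul_comm]
  rw [h2, IsNilpotent.exp_eq_sum hm1, Finset.sum_mul, map_sum, Finset.sum_mul,
    Finset.sum_range_succ', Finset.sum_range_succ' (fun k => _ * D y), ← add_assoc,
    ← Finset.sum_add_distrib]
  congr 1
  · refine Finset.sum_congr rfl fun k _ => ?_
    rw [smul_mul_assoc, hrat, hpow, smul_add, smul_smul, smul_mul_assoc, Nat.factorial_succ]
    congr 2
    have : (k.factorial : ℚ) ≠ 0 := by positivity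
    push_cast
    field_simp
  · simp

variable {ι : Type*}

theorem anticomm_mul_mul {e : ι → A} (he : ∀ i j, e i * e j = -(e j * e i)) (i j k : ι) :
    e k * (e i * e j) = e i * e j * e k := by
  rw [← mul_assoc, he k i, neg_mul, mul_assoc, he k j, mul_neg, neg_neg, mul_assoc]

variable [Algebra ℂ A]

theorem anticomm_mul_self {e : ι → A} (he : ∀ i j, e i * e j = -(e j * e i)) (i : ι) :
    e i * e i = 0 := by
  have h := he i i
  rw [eq_neg_iff_add_eq_zero, ← two_smul ℂ] at h
  exact (smul_eq_zero.1 h).resolve_left two_ne_zero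

variable [Fintype ι]

theorem commute_quadratic {e : ι → A} (he : ∀ i j, e i * e j = -(e j * e i)) (w : ι → ι → ℂ)
    (k : ι) : Commute (∑ i, ∑ j, w i j • (e i * e j)) (e k) := by
  refine Commute.sum_left _ _ _ fun i _ => Commute.sum_left _ _ _ fun j _ => ?_
  exact Commute.smul_left (anticomm_mul_mul he i j k).symm _

/-- Quadratic expressions in anticommuting variables are nilpotent. -/
theorem isNilpotent_quadratic {e : ι → A} (he : ∀ i j, e i * e j = -(e j * e i))
    (w : ι → ι → ℂ) : IsNilpotent (∑ i, ∑ j, w i j • (e i * e j)) := by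
  have hc : ∀ i j k l, Commute (w i j • (e i * e j)) (w k l • (e k * e l)) := by
    intro i j k l
    refine (Commute.mul_right ?_ ?_).smul_left _ |>.smul_right _
    · exact (anticomm_mul_mul he i j k).symm
    · exact (anticomm_mul_mul he i j l).symm
  rw [← Finset.sum_product' Finset.univ Finset.univ fun i j => w i j • (e i * e j)]
  refine Commute.isNilpotent_sum (fun p _ => ⟨2, ?_⟩) fun p q _ _ => hc _ _ _ _
  rw [smul_pow, sq (e _ * e _), ← mul_assoc, mul_assoc (e p.1), he p.2, mul_neg, ← mul_assoc,
    anticomm_mul_self he, zero_mul, neg_zero, zero_mul, smul_zero]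

end Exponential

/-! ### Canonical anticommutation relations -/

section Car

variable {V : Type*} [Fintype V] [DecidableEq V]

theorem fermionSign_mul_self (A : Finset V) (x : V) : fermionSign A x * fermionSign A x = 1 := by
  unfold fermionSign
  rw [← mul_pow]; simp

theorem star_fermionSign (A : Finset V) (x : V) : star (fermionSign A x) = fermionSign A x := by
  unfold fermionSign
  simp

theorem fermionSign_insert_self (A : Finset V) (x : V) :
    fermionSign (insert x A) x = fermionSign A x := by
  unfold fermionSign
  rw [Finset.filter_insert]
  simp

theorem annihilate_apply (x : V) (ψ : Fock V) (A : Finset V) :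
    annihilate x ψ A = if x ∈ A then 0 else fermionSign A x * ψ (insert x A) := by
  have h : ⟪EuclideanSpace.single A (1 : ℂ), annihilate x ψ⟫_ℂ
      = ⟪create x (EuclideanSpace.single A (1 : ℂ)), ψ⟫_ℂ := by
    rw [annihilate, LinearMap.adjoint_inner_right]
  rw [EuclideanSpace.inner_single_left, map_one, one_mul, PiLp.inner_apply] at h
  rw [h]
  by_cases hx : x ∈ A
  · rw [if_pos hx]
    refine Finset.sum_eq_zero fun B _ => ?_
    have : create x (EuclideanSpace.single A (1 : ℂ)) B = 0 := by
      rw [create_apply]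
      split_ifs with hB
      · have : B.erase x ≠ A := fun h => by simp [← h] at hx
        simp [this]
      · rfl
    simp [this]
  · rw [if_neg hx, Finset.sum_eq_single (insert x A)]
    · simp [create_apply, Finset.erase_insert hx, fermionSign_insert_self]
      rw [starRingEnd_apply, star_fermionSign, mul_comm]
    · intro B _ hB
      have : create x (EuclideanSpace.single A (1 : ℂ)) B = 0 := by
        rw [create_apply]
        split_ifs with hB'
        · have : B.erase x ≠ A := fun h => hB (by rw [← h, Finset.insert_erase hB'])
          simp [this]
        · rfl
      simp [this]
    · simp

theorem annihilate_mul_create (x y : V) :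
    annihilate x * create y + create y * annihilate x = if x = y then 1 else 0 := by
  ext1 ψ
  ext A
  simp only [LinearMap.add_apply, Module.End.mul_apply, PiLp.add_apply, annihilate_apply,
    create_apply]
  by_cases hxy : x = y
  · subst hxy
    by_cases hx : x ∈ A
    · simp [hx, ← mul_assoc, fermionSign_erase_of_not_lt, fermionSign_mul_self]
    · simp [hx, ← mul_assoc, fermionSign_insert_self, fermionSign_mul_self]
  by_cases hx : x ∈ A
  · simp [hx, hxy]
  by_cases hy : y ∈ A
  · have h1 := fermionSign_erase_of_not_lt (A := insert x A) (x := x) (y := y)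
    have h2 := fun h => fermionSign_erase_of_lt (y := y) (Finset.mem_insert_self x A) h
    rw [Finset.erase_insert hx] at h1 h2
    have h3 : Fintype.equivFin V x ≠ Fintype.equivFin V y := by simpa using hxy
    simp only [hx, hy, hxy, if_false, if_true, Finset.mem_insert, or_true, Finset.mem_erase,
      and_false, LinearMap.zero_apply, PiLp.zero_apply, Finset.erase_insert_of_ne hxy]
    rcases lt_or_gt_of_ne h3 with h | h
    · rw [fermionSign_erase_of_not_lt (not_lt.2 h.le), h2 h]
      ring
    · rw [fermionSign_erase_of_lt hy h, h1 (not_lt.2 h.le)]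
      ring
  · simp [hx, hy, hxy, Ne.symm hxy]

theorem annihilate_vacuum (x : V) : annihilate x (vacuum : Fock V) = 0 := by
  ext A
  simp [annihilate_apply, vacuum]

theorem vacuum_ne_zero : (vacuum : Fock V) ≠ 0 := by
  simp [vacuum]

theorem eq_smul_vacuum {χ : Fock V} (h : ∀ x, annihilate x χ = 0) : χ = χ ∅ • vacuum := by
  ext A
  rcases A.eq_empty_or_nonempty with rfl | ⟨x, hx⟩
  · simp [vacuum]
  · have h1 := congrArg (fun φ : Fock V => φ (A.erase x)) (h x)
    simp only [annihilate_apply, Finset.notMem_erase, if_false, Finset.insert_erase hx,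
      PiLp.zero_apply, mul_eq_zero] at h1
    have h2 : fermionSign (A.erase x) x ≠ 0 := fun h0 => by
      simpa [h0] using fermionSign_mul_self (A.erase x) x
    have h3 : A ≠ ∅ := Finset.ne_empty_of_mem hx
    simp [vacuum, h1.resolve_left h2, h3]

end Car

/-! ### Bogoliubov transformations -/

section Bogoliubov

variable {F : Type*} [NormedAddCommGroup F] [InnerProductSpace ℂ F] [FiniteDimensional ℂ F]
  {ι : Type*} [DecidableEq ι]

/-- `ad k` are the creation operators of a complete set of fermionic modes, with vacuum `v`. -/
structure IsModes (ad : ι → Module.End ℂ F) (v : F) : Prop where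
  anticomm : ∀ k l, ad k * ad l = -(ad l * ad k)
  car : ∀ k l, LinearMap.adjoint (ad k) * ad l + ad l * LinearMap.adjoint (ad k)
    = if k = l then 1 else 0
  vac_ne_zero : v ≠ 0
  annihilate_vac : ∀ k, LinearMap.adjoint (ad k) v = 0
  eq_smul_vac : ∀ χ, (∀ k, LinearMap.adjoint (ad k) χ = 0) → ∃ c : ℂ, χ = c • v

theorem adjoint_mul (S T : Module.End ℂ F) :
    LinearMap.adjoint (S * T) = LinearMap.adjoint T * LinearMap.adjoint S :=
  LinearMap.adjoint_comp _ _

namespace IsModes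

variable {ad : ι → Module.End ℂ F} {v : F} (h : IsModes ad v)
include h

theorem adjoint_anticomm (k l : ι) : LinearMap.adjoint (ad k) * LinearMap.adjoint (ad l)
    = -(LinearMap.adjoint (ad l) * LinearMap.adjoint (ad k)) := by
  simpa [adjoint_mul] using congrArg LinearMap.adjoint (h.anticomm l k)

theorem car' (k l : ι) : ad l * LinearMap.adjoint (ad k)
    = (if k = l then 1 else 0) - LinearMap.adjoint (ad k) * ad l := by
  rw [← h.car k l]; abel

end IsModes

variable [Fintype ι] [InvolutiveNeg ι]

/-- The quasiparticle annihilation operator `a_k - g_k a_{-k}†`. -/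
def quasi (ad : ι → Module.End ℂ F) (g : ι → ℂ) (k : ι) : Module.End ℂ F :=
  LinearMap.adjoint (ad k) - g k • ad (-k)

theorem adjoint_quasi (ad : ι → Module.End ℂ F) (g : ι → ℂ) (k : ι) :
    LinearMap.adjoint (quasi ad g k)
      = ad k - (starRingEnd ℂ) (g k) • LinearMap.adjoint (ad (-k)) := by
  simp [quasi, map_smulₛₗ]

namespace IsModes

variable {ad : ι → Module.End ℂ F} {v : F} (h : IsModes ad v) {g : ι → ℂ}
include h

theorem quasi_car (k l : ι) : quasi ad g k * LinearMap.adjoint (quasi ad g l)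
      + LinearMap.adjoint (quasi ad g l) * quasi ad g k
      = if k = l then (1 + g k * (starRingEnd ℂ) (g k)) • (1 : Module.End ℂ F) else 0 := by
  have h1 := h.adjoint_anticomm k (-l)
  have h2 := h.anticomm (-k) l
  have h3 := h.car' k l
  have h4 := h.car' (-l) (-k)
  have h5 : (-l = -k) = (k = l) := by
    rw [neg_inj, eq_comm (a := l)]
  rw [adjoint_quasi]
  simp only [quasi, mul_sub, sub_mul, smul_mul_assoc, mul_smul_comm, h3, h4, h1, h2, h5]
  split_ifs with hkl
  · subst hkl
    module
  · module

theorem norm_adjoint_quasi_apply_sq (k : ι) (χ : F) :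
    ‖LinearMap.adjoint (quasi ad g k) χ‖ ^ 2 + ‖quasi ad g k χ‖ ^ 2
      = (1 + ‖g k‖ ^ 2) * ‖χ‖ ^ 2 := by
  have h1 := congrArg (fun T : Module.End ℂ F => ⟪χ, T χ⟫_ℂ) (h.quasi_car (g := g) k k)
  simp only [if_true, LinearMap.add_apply, Module.End.mul_apply, inner_add_right,
    LinearMap.smul_apply, Module.End.one_apply, inner_smul_right, Complex.mul_conj] at h1
  rw [LinearMap.adjoint_inner_right, ← LinearMap.adjoint_inner_left, inner_self_eq_norm_sq_to_K,
    inner_self_eq_norm_sq_to_K, inner_self_eq_norm_sq_to_K, Complex.normSq_eq_norm_sq] at h1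
  rw [← Complex.ofReal_inj]
  push_cast at h1 ⊢
  exact h1

variable (hg : ∀ k, g (-k) = -g k)
include hg

theorem quasi_anticomm (k l : ι) : quasi ad g k * quasi ad g l = -(quasi ad g l * quasi ad g k) := by
  have h1 := h.adjoint_anticomm k l
  have h2 := h.anticomm (-k) (-l)
  have h3 := h.car' k (-l)
  have h4 := h.car' l (-k)
  have h5 : (k = -l) = (l = -k) := by
    apply propext; constructor <;> (rintro h; rw [h, neg_neg])
  simp only [quasi, mul_sub, sub_mul, smul_mul_assoc, mul_smul_comm, h3, h4, h1, h2, h5]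
  split_ifs with hkl
  · subst hkl
    rw [hg]
    module
  · module

/-- The common kernel of the quasiparticle annihilation operators is one-dimensional. -/
theorem exists_quasi_vacuum : ∃ ψ : F, ‖ψ‖ = 1 ∧ (∀ k, quasi ad g k ψ = 0) ∧
    ∀ χ, (∀ k, quasi ad g k χ = 0) → ∃ c : ℂ, χ = c • ψ := by
  let : Algebra ℚ (Module.End ℂ F) := Algebra.compHom _ (algebraMap ℚ ℂ)
  set K : Module.End ℂ F := ∑ k, ∑ l, (if l = -k then g k / 2 else 0) • (ad k * ad l) with hK
  have hnil : IsNilpotent K := isNilpotent_quadratic h.anticomm _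
  have hD : ∀ l y, LinearMap.adjoint (ad l) * (K * y)
      = (g l • ad (-l)) * y + K * (LinearMap.adjoint (ad l) * y) := by
    intro l y
    have h1 : LinearMap.adjoint (ad l) * K = g l • ad (-l) + K * LinearMap.adjoint (ad l) := by
      have h2 : ∀ k, LinearMap.adjoint (ad l) * (ad k * ad (-k))
          = (if l = k then 1 else 0) * ad (-k) - ad k * (if l = -k then 1 else 0)
            + ad k * ad (-k) * LinearMap.adjoint (ad l) := by
        intro k
        rw [← h.car, ← h.car]
        noncomm_ring
      have h3 : ∀ k, (l = -k) = (-l = k) := fun k => by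
        rw [neg_eq_iff_eq_neg]
      simp only [hK, ite_smul, zero_smul, Finset.sum_ite_eq', Finset.mem_univ, if_true,
        Finset.mul_sum, Finset.sum_mul, mul_smul_comm, smul_mul_assoc, h2, smul_add, smul_sub,
        Finset.sum_add_distrib, Finset.sum_sub_distrib, h3, ite_mul, mul_ite, one_mul, mul_one,
        zero_mul, mul_zero, smul_ite, smul_zero, Finset.sum_ite_eq, hg]
      module
    rw [← mul_assoc, h1, add_mul, mul_assoc]
  have hW : ∀ l, quasi ad g l * IsNilpotent.exp K
      = IsNilpotent.exp K * LinearMap.adjoint (ad l) := by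
    intro l
    have := map_exp_mul (((commute_quadratic h.anticomm _ (-l)).smul_right (g l))) hnil
      (AddMonoidHom.mulLeft (LinearMap.adjoint (ad l))) (hD l) 1
    simp only [AddMonoidHom.coe_mulLeft, mul_one] at this
    rw [quasi, sub_mul, this, add_sub_cancel_left]
  have hinv := IsNilpotent.exp_neg_mul_exp_self hnil
  have hinv' := IsNilpotent.exp_mul_exp_neg_self hnil
  set W := IsNilpotent.exp K
  set W' := IsNilpotent.exp (-K)
  have hne : W v ≠ 0 := fun h0 => h.vac_ne_zero <| by
    rw [← Module.End.one_apply (R := ℂ) v, ← hinv, Module.End.mul_apply, h0, map_zero]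
  refine ⟨((‖W v‖ : ℂ)⁻¹) • W v, ?_, fun k => ?_, fun χ hχ => ?_⟩
  · rw [norm_smul, norm_inv, Complex.norm_real, norm_norm, inv_mul_cancel₀ (norm_ne_zero_iff.2 hne)]
  · rw [map_smul, ← Module.End.mul_apply, hW, Module.End.mul_apply, h.annihilate_vac, map_zero,
      smul_zero]
  · obtain ⟨c, hc⟩ := h.eq_smul_vac (W' χ) fun k => by
      have h1 : LinearMap.adjoint (ad k) * W' = W' * quasi ad g k := by
        calc LinearMap.adjoint (ad k) * W' = W' * (W * LinearMap.adjoint (ad k)) * W' := by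
              rw [← mul_assoc W', hinv, one_mul]
          _ = W' * quasi ad g k * (W * W') := by rw [← hW]; simp only [mul_assoc]
          _ = _ := by rw [hinv', mul_one]
      rw [← Module.End.mul_apply, h1, Module.End.mul_apply, hχ, map_zero]
    refine ⟨c * ‖W v‖, ?_⟩
    have : χ = W (W' χ) := by rw [← Module.End.mul_apply, hinv', Module.End.one_apply]
    rw [this, hc, map_smul, smul_smul, mul_assoc, mul_inv_cancel₀, mul_one]
    simpa using hne

/-- Projecting onto the kernel of one quasiparticle annihilation operator. -/
theorem exists_quasi_projection (k : ι) : ∃ Q : Module.End ℂ F,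
    (∀ χ, quasi ad g k (Q χ) = 0) ∧ (∀ j, j ≠ k → ∀ χ, quasi ad g j (Q χ) = Q (quasi ad g j χ)) ∧
    (∀ χ, ‖Q χ‖ ≤ ‖χ‖) ∧ ∀ (δ : ℝ) (χ : F), 0 ≤ δ → ‖quasi ad g k χ‖ ≤ δ * ‖g k‖ → ‖χ - Q χ‖ ≤ δ := by
  have hcar := h.quasi_car (g := g) k k
  rw [if_pos rfl, Complex.mul_conj, Complex.normSq_eq_norm_sq] at hcar
  have hnorm := h.norm_adjoint_quasi_apply_sq (g := g) k
  have hsq : quasi ad g k * quasi ad g k = 0 := anticomm_mul_self (h.quasi_anticomm hg) k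
  have hsq' := congrArg LinearMap.adjoint hsq
  rw [adjoint_mul, map_zero] at hsq'
  have hj : ∀ j, j ≠ k → quasi ad g j * (quasi ad g k * LinearMap.adjoint (quasi ad g k))
      = quasi ad g k * LinearMap.adjoint (quasi ad g k) * quasi ad g j := by
    intro j hjk
    have h1 := h.quasi_car (g := g) j k
    rw [if_neg hjk, add_eq_zero_iff_eq_neg] at h1
    rw [← mul_assoc, h.quasi_anticomm hg, neg_mul, mul_assoc, h1, mul_neg, neg_neg, mul_assoc]
  set b := quasi ad g k with hb
  set b' := LinearMap.adjoint b with hb'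
  set c : ℝ := 1 + ‖g k‖ ^ 2 with hc
  have hcpos : 0 < c := by positivity
  have hc0 : (c : ℂ) ≠ 0 := by exact_mod_cast hcpos.ne'
  have hcar' : b * b' + b' * b = (c : ℂ) • (1 : Module.End ℂ F) := by
    rw [hcar, hc]; push_cast; rfl
  have hcompl : ∀ χ, χ - ((c : ℂ)⁻¹ • (b * b')) χ = (c : ℂ)⁻¹ • b' (b χ) := by
    intro χ
    have h1 := congrArg (fun T : Module.End ℂ F => (c : ℂ)⁻¹ • T χ) hcar'
    simp only [LinearMap.add_apply, LinearMap.smul_apply, Module.End.one_apply, smul_smul,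
      inv_mul_cancel₀ hc0, one_smul, smul_add] at h1
    rw [sub_eq_iff_eq_add]
    exact h1.symm.trans (add_comm _ _)
  refine ⟨(c : ℂ)⁻¹ • (b * b'), fun χ => ?_, fun j hjk χ => ?_, fun χ => ?_, fun δ χ hδ0 hδ => ?_⟩
  · rw [LinearMap.smul_apply, map_smul, ← Module.End.mul_apply, ← mul_assoc, hsq, zero_mul,
      LinearMap.zero_apply, smul_zero]
  · rw [LinearMap.smul_apply, map_smul, ← Module.End.mul_apply, hj j hjk, LinearMap.smul_apply,
      Module.End.mul_apply]
  · have h0 : ⟪((c : ℂ)⁻¹ • (b * b')) χ, χ - ((c : ℂ)⁻¹ • (b * b')) χ⟫_ℂ = 0 := by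
      rw [hcompl, LinearMap.smul_apply, inner_smul_left, inner_smul_right, Module.End.mul_apply,
        ← LinearMap.adjoint_inner_right, ← hb', ← Module.End.mul_apply (f := b') (g := b'), hsq']
      simp
    have h1 := norm_add_sq_eq_norm_sq_add_norm_sq_of_inner_eq_zero _ _ h0
    rw [add_sub_cancel] at h1
    nlinarith [norm_nonneg χ, mul_self_nonneg ‖χ - ((c : ℂ)⁻¹ • (b * b')) χ‖,
      norm_nonneg (((c : ℂ)⁻¹ • (b * b')) χ)]
  · rw [hcompl, norm_smul, norm_inv, Complex.norm_real, Real.norm_of_nonneg hcpos.le,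
      inv_mul_le_iff₀ hcpos]
    refine abs_le_of_sq_le_sq' ?_ (by positivity) |>.2
    calc ‖b' (b χ)‖ ^ 2 ≤ c * ‖b χ‖ ^ 2 := by nlinarith [hnorm (b χ), sq_nonneg ‖b (b χ)‖]
      _ ≤ c * (δ * ‖g k‖) ^ 2 := by gcongr
      _ ≤ (c * δ) ^ 2 := by
        rw [mul_pow, mul_pow, sq c, mul_assoc]
        gcongr c * ?_
        rw [mul_comm c]
        gcongr
        linarith

/-- A vector that the quasiparticle annihilation operators almost annihilate is close to the
quasiparticle vacuum. -/
theorem norm_inner_quasi_vacuum {ψ φ : F} (hψ : ‖ψ‖ = 1) (hφ : ‖φ‖ = 1)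
    (hψu : ∀ χ, (∀ k, quasi ad g k χ = 0) → ∃ c : ℂ, χ = c • ψ) {δ : ℝ} (hδ0 : 0 ≤ δ)
    (hδ : ∀ k, ‖quasi ad g k φ‖ ≤ δ * ‖g k‖) :
    1 - 2 * (Fintype.card ι * δ) ≤ ‖⟪φ, ψ⟫_ℂ‖ := by
  have hl : ∀ l : List ι, ∃ χ, ‖φ - χ‖ ≤ l.length * δ ∧ ∀ k ∈ l, quasi ad g k χ = 0 := by
    intro l
    induction l with
    | nil => exact ⟨φ, by simp⟩
    | cons k l ih =>
      obtain ⟨χ, h1, h2⟩ := ih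
      obtain ⟨Q, q1, q2, q3, q4⟩ := h.exists_quasi_projection hg k
      refine ⟨Q χ, ?_, fun j hj => ?_⟩
      · calc ‖φ - Q χ‖ = ‖(φ - Q φ) + Q (φ - χ)‖ := by rw [map_sub]; congr 1; abel
          _ ≤ δ + l.length * δ :=
            (norm_add_le _ _).trans (add_le_add (q4 δ φ hδ0 (hδ k)) ((q3 _).trans h1))
          _ = _ := by simp; ring
      · by_cases hjk : j = k
        · rw [hjk, q1]
        · rw [q2 j hjk, h2 j ((List.mem_cons.1 hj).resolve_left hjk), map_zero]
  obtain ⟨χ, h1, h2⟩ := hl Finset.univ.toList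
  obtain ⟨c, rfl⟩ := hψu χ fun k => h2 k (by simp)
  rw [Finset.length_toList, Finset.card_univ] at h1
  have h3 : ⟪φ, ψ⟫_ℂ = (starRingEnd ℂ) c + ⟪φ - c • ψ, ψ⟫_ℂ := by
    rw [inner_sub_left, inner_smul_left, inner_self_eq_norm_sq_to_K, hψ]; simp
  have h4 : ‖φ‖ ≤ ‖φ - c • ψ‖ + ‖c‖ := by
    calc ‖φ‖ = ‖(φ - c • ψ) + c • ψ‖ := by rw [sub_add_cancel]
      _ ≤ _ := (norm_add_le _ _).trans (by rw [norm_smul, hψ, mul_one])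
  have h5 : ‖⟪φ - c • ψ, ψ⟫_ℂ‖ ≤ ‖φ - c • ψ‖ := by
    have := norm_inner_le_norm (𝕜 := ℂ) (φ - c • ψ) ψ
    rwa [hψ, mul_one] at this
  have h6 : ‖c‖ ≤ ‖⟪φ, ψ⟫_ℂ‖ + ‖⟪φ - c • ψ, ψ⟫_ℂ‖ := by
    calc ‖c‖ = ‖⟪φ, ψ⟫_ℂ - ⟪φ - c • ψ, ψ⟫_ℂ‖ := by rw [h3, add_sub_cancel_right, RCLike.norm_conj]
      _ ≤ _ := norm_sub_le _ _
  linarith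

end IsModes

end Bogoliubov

/-! ### Momentum modes -/

section Momentum

variable {n : ℕ} [NeZero n]

/-- The plane wave `e^{i k x}` on the torus. -/
def wave (k x : Site n) : ℂ := ZMod.stdAddChar (k.1 * x.1 + k.2 * x.2)

theorem wave_comm (k x : Site n) : wave k x = wave x k := by
  simp [wave, mul_comm]

theorem wave_add_right (k x y : Site n) : wave k (x + y) = wave k x * wave k y := by
  rw [wave, wave, wave, ← AddChar.map_add_eq_mul]
  congr 1
  simp only [Prod.fst_add, Prod.snd_add]
  ring

theorem wave_add_left (k l x : Site n) : wave (k + l) x = wave k x * wave l x := by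
  rw [wave_comm, wave_add_right, wave_comm x, wave_comm x]

theorem wave_neg_left (k x : Site n) : wave (-k) x = (starRingEnd ℂ) (wave k x) := by
  rw [wave, wave, ← AddChar.map_neg_eq_conj]
  congr 1
  simp only [Prod.fst_neg, Prod.snd_neg]
  ring

theorem wave_neg_right (k x : Site n) : wave k (-x) = wave (-k) x := by
  simp [wave]

theorem wave_zero_left (x : Site n) : wave 0 x = 1 := by simp [wave]

theorem wave_zero_right (k : Site n) : wave k 0 = 1 := by simp [wave]

theorem sum_wave_right (k : Site n) : ∑ x, wave k x = if k = 0 then (n : ℂ) ^ 2 else 0 := by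
  have h := fun b : ZMod n => AddChar.sum_mulShift b (ZMod.isPrimitive_stdAddChar n)
  simp only [ZMod.card] at h
  rw [Fintype.sum_prod_type]
  simp only [wave, AddChar.map_add_eq_mul, ← Finset.mul_sum, ← Finset.sum_mul]
  simp only [mul_comm k.1, mul_comm k.2, h]
  by_cases h1 : k.1 = 0 <;> by_cases h2 : k.2 = 0 <;> simp [h1, h2, Prod.ext_iff, sq]

theorem sum_wave_left (x : Site n) : ∑ k, wave k x = if x = 0 then (n : ℂ) ^ 2 else 0 := by
  simp only [wave_comm _ x, sum_wave_right]

theorem natCast_ne_zero : (n : ℂ) ≠ 0 := Nat.cast_ne_zero.2 (NeZero.ne n)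

/-- The Parseval identity, for operators. -/
theorem sum_wave_mul {A : Type*} [Ring A] [Algebra ℂ A] (v : Site n) (X Y : Site n → A) :
    ∑ k, wave (-k) v • ((∑ x, wave k x • X x) * ∑ y, wave (-k) y • Y y)
      = (n : ℂ) ^ 2 • ∑ y, X (y + v) * Y y := by
  have h : ∀ k x y : Site n, wave (-k) v * (wave k x * wave (-k) y) = wave k (x - (y + v)) := by
    intro k x y
    rw [sub_eq_add_neg, wave_add_right, wave_neg_right, wave_add_right]
    ring
  simp only [Finset.sum_mul_sum, Finset.smul_sum, smul_mul_smul_comm, smul_smul, h]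
  rw [Finset.sum_comm]
  have h2 : ∀ x, ∑ k, ∑ y, wave k (x - (y + v)) • (X x * Y y)
      = ∑ y, if x = y + v then (n : ℂ) ^ 2 • (X x * Y y) else 0 := by
    intro x
    rw [Finset.sum_comm]
    refine Finset.sum_congr rfl fun y _ => ?_
    rw [← Finset.sum_smul, sum_wave_left]
    simp [sub_eq_zero]
  simp only [h2]
  rw [Finset.sum_comm]
  simp

/-- The creation operator of a plane wave. -/
def momCreate (k : Site n) : Module.End ℂ (Fock (Site n)) :=
  (n : ℂ)⁻¹ • ∑ x, wave k x • create x

theorem adjoint_momCreate (k : Site n) : LinearMap.adjoint (momCreate k)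
    = (n : ℂ)⁻¹ • ∑ x, wave (-k) x • annihilate x := by
  simp [momCreate, map_smulₛₗ, wave_neg_left, annihilate]

theorem annihilate_eq_sum (x : Site n) :
    annihilate x = (n : ℂ)⁻¹ • ∑ k, wave k x • LinearMap.adjoint (momCreate k) := by
  have h : ∀ k y : Site n, wave k x * wave (-k) y = wave k (x - y) := by
    intro k y
    rw [sub_eq_add_neg, wave_add_right, wave_neg_right]
  simp only [adjoint_momCreate, smul_comm (wave _ x), smul_smul]
  simp only [Finset.smul_sum, smul_smul]
  rw [Finset.sum_comm]
  simp only [mul_assoc, h, ← Finset.sum_smul, ← Finset.mul_sum, sum_wave_left, sub_eq_zero]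
  simp
  field_simp [natCast_ne_zero (n := n)]
  simp

theorem isModes_momCreate : IsModes (momCreate (n := n)) vacuum where
  anticomm k l := by
    simp only [momCreate, smul_mul_smul_comm, Finset.sum_mul_sum]
    rw [← smul_neg, Finset.sum_comm]
    simp only [← Finset.sum_neg_distrib]
    refine congrArg _ (Finset.sum_congr rfl fun x _ => Finset.sum_congr rfl fun y _ => ?_)
    rw [create_mul_create, smul_neg, mul_comm]
  car k l := by
    have h : ∀ x : Site n, wave (-k) x * wave l x = wave (l - k) x := by
      intro x
      rw [sub_eq_neg_add, wave_add_left]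
    rw [adjoint_momCreate, momCreate]
    simp only [smul_mul_smul_comm, Finset.sum_mul_sum, ← smul_add]
    rw [Finset.sum_comm (f := fun x y => (wave l x * wave (-k) y) • (create x * annihilate y))]
    simp only [← Finset.sum_add_distrib, mul_comm (wave l _), ← smul_add, annihilate_mul_create,
      smul_ite, smul_zero, Finset.sum_ite_eq, Finset.mem_univ, if_true, h, ← Finset.sum_smul,
      sum_wave_right, sub_eq_zero, eq_comm (a := l)]
    split_ifs
    · rw [smul_smul, ← sq, ← mul_pow, inv_mul_cancel₀ natCast_ne_zero, one_pow, one_smul]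
    · simp
  vac_ne_zero := vacuum_ne_zero
  annihilate_vac k := by simp [adjoint_momCreate, annihilate_vacuum]
  eq_smul_vac χ h := ⟨_, eq_smul_vacuum fun x => by simp [annihilate_eq_sum, h]⟩

end Momentum

/-! ### Dispersion relation -/

section Dispersion

variable {n : ℕ} [NeZero n]

/-- The kinetic energy `2 (cos k₁ + cos k₂ - μ)`. -/
def kinetic (μ : ℝ) (k : Site n) : ℝ :=
  2 * ((ZMod.stdAddChar k.1).re + (ZMod.stdAddChar k.2).re - μ)

/-- The pairing amplitude `2 (sin k₂ - i sin k₁)`. -/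
def pairing (k : Site n) : ℂ :=
  2 * ((ZMod.stdAddChar k.2).im - Complex.I * (ZMod.stdAddChar k.1).im)

/-- The quasiparticle energy. -/
def dispersion (μ : ℝ) (k : Site n) : ℝ := √(kinetic μ k ^ 2 + ‖pairing k‖ ^ 2)

/-- The amplitude for the presence of a pair in the ground state. -/
def pairAmplitude (μ : ℝ) (k : Site n) : ℂ :=
  -pairing k / (dispersion μ k + kinetic μ k : ℝ)

theorem kinetic_neg (μ : ℝ) (k : Site n) : kinetic μ (-k) = kinetic μ k := by
  simp [kinetic, AddChar.map_neg_eq_conj]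

theorem pairing_neg (k : Site n) : pairing (-k) = -pairing k := by
  simp [pairing, AddChar.map_neg_eq_conj]
  ring

theorem dispersion_neg (μ : ℝ) (k : Site n) : dispersion μ (-k) = dispersion μ k := by
  simp [dispersion, kinetic_neg, pairing_neg]

theorem pairAmplitude_neg (μ : ℝ) (k : Site n) : pairAmplitude μ (-k) = -pairAmplitude μ k := by
  simp [pairAmplitude, kinetic_neg, pairing_neg, dispersion_neg, neg_div]

theorem norm_pairing_sq (k : Site n) : ‖pairing k‖ ^ 2
    = 4 * ((ZMod.stdAddChar k.1).im ^ 2 + (ZMod.stdAddChar k.2).im ^ 2) := by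
  rw [← Complex.normSq_eq_norm_sq, Complex.normSq_apply]
  simp [pairing]
  ring

theorem dispersion_sq (μ : ℝ) (k : Site n) :
    dispersion μ k ^ 2 = kinetic μ k ^ 2 + ‖pairing k‖ ^ 2 :=
  Real.sq_sqrt (by positivity)

theorem re_sq_add_im_sq_stdAddChar (j : ZMod n) :
    (ZMod.stdAddChar j).re ^ 2 + (ZMod.stdAddChar j).im ^ 2 = 1 := by
  have := AddChar.norm_apply (ZMod.stdAddChar (N := n)) j
  rw [← one_pow 2, ← this, ← Complex.normSq_eq_norm_sq, Complex.normSq_apply]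
  ring

theorem natCast_le_sq_mul_norm_one_sub {n : ℕ} {w : ℂ} (hw : w ^ n = 1) (hw1 : w ≠ 1)
    (hnorm : ‖w‖ = 1) : (n : ℝ) ≤ n * n * ‖1 - w‖ := by
  have h1 : ∑ m ∈ Finset.range n, w ^ m = 0 := by
    rw [geom_sum_eq hw1, hw, sub_self, zero_div]
  have h2 : ∀ m : ℕ, ‖1 - w ^ m‖ ≤ m * ‖1 - w‖ := by
    intro m
    induction m with
    | zero => simp
    | succ m ih =>
      calc ‖1 - w ^ (m + 1)‖ = ‖(1 - w ^ m) + w ^ m * (1 - w)‖ := by ring_nf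
        _ ≤ m * ‖1 - w‖ + ‖1 - w‖ := by
          refine (norm_add_le _ _).trans (add_le_add ih ?_)
          rw [norm_mul, norm_pow, hnorm, one_pow, one_mul]
        _ = _ := by push_cast; ring
  calc (n : ℝ) = ‖∑ m ∈ Finset.range n, (1 - w ^ m)‖ := by
        rw [Finset.sum_sub_distrib, h1]; simp
    _ ≤ ∑ m ∈ Finset.range n, (n : ℝ) * ‖1 - w‖ := by
        refine norm_sum_le_of_le _ fun m hm => (h2 m).trans ?_
        gcongr
        exact (Finset.mem_range.1 hm).le
    _ = _ := by simp; ring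

/-- On an odd torus the pairing vanishes only at zero momentum, with a polynomial lower bound. -/
theorem one_le_norm_pairing (hn : Odd n) {k : Site n} (hk : k ≠ 0) :
    1 ≤ (n : ℝ) ^ 2 * ‖pairing k‖ ^ 2 := by
  have hn0 : (0 : ℝ) < n := Nat.cast_pos.2 (Nat.pos_of_ne_zero (NeZero.ne n))
  have key : ∀ j : ZMod n, j ≠ 0 → 1 ≤ (n : ℝ) ^ 2 * (4 * (ZMod.stdAddChar j).im ^ 2) := by
    intro j hj
    have h2j : j + j ≠ 0 := by
      rw [← two_mul]
      have : IsUnit (2 : ZMod n) := by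
        have := (ZMod.isUnit_iff_coprime 2 n).2 (Nat.coprime_two_left.2 hn)
        exact_mod_cast this
      rwa [Ne, this.mul_right_eq_zero]
    have h1 : (ZMod.stdAddChar (j + j) : ℂ) ^ n = 1 := by
      rw [← AddChar.map_nsmul_eq_pow]; simp
    have h2 : (ZMod.stdAddChar (j + j) : ℂ) ≠ 1 := by
      rw [← AddChar.map_zero_eq_one (ZMod.stdAddChar (N := n))]
      exact fun h => h2j (ZMod.injective_stdAddChar h)
    have h3 := natCast_le_sq_mul_norm_one_sub h1 h2 (AddChar.norm_apply _ _)
    have h4 : ‖1 - (ZMod.stdAddChar (j + j) : ℂ)‖ ^ 2 = 4 * (ZMod.stdAddChar j).im ^ 2 := by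
      rw [← Complex.normSq_eq_norm_sq, Complex.normSq_apply, AddChar.map_add_eq_mul]
      simp only [Complex.sub_re, Complex.sub_im, Complex.mul_re, Complex.mul_im, Complex.one_re,
        Complex.one_im]
      have := re_sq_add_im_sq_stdAddChar j
      generalize (ZMod.stdAddChar j).re = a at *
      generalize (ZMod.stdAddChar j).im = b at *
      linear_combination (a ^ 2 + b ^ 2 - 1) * this
    rw [← h4, ← mul_pow]
    have h5 : 1 ≤ (n : ℝ) * ‖1 - (ZMod.stdAddChar (j + j) : ℂ)‖ := by
      rw [mul_assoc] at h3
      exact le_of_mul_le_mul_left (by rwa [mul_one]) hn0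
    exact one_le_pow₀ h5
  rw [norm_pairing_sq]
  by_cases h1 : k.1 = 0
  · have h2 : k.2 ≠ 0 := fun h2 => hk (Prod.ext h1 h2)
    nlinarith [key _ h2, mul_nonneg (sq_nonneg (n : ℝ)) (sq_nonneg (ZMod.stdAddChar k.1).im)]
  · nlinarith [key _ h1, mul_nonneg (sq_nonneg (n : ℝ)) (sq_nonneg (ZMod.stdAddChar k.2).im)]

theorem kinetic_le_dispersion (μ : ℝ) (k : Site n) : |kinetic μ k| ≤ dispersion μ k :=
  Real.abs_le_sqrt (by nlinarith [sq_nonneg ‖pairing k‖])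

theorem kinetic_zero (μ : ℝ) : kinetic μ (0 : Site n) = 2 * (2 - μ) := by
  simp [kinetic]; ring

theorem pairing_zero : pairing (0 : Site n) = 0 := by
  simp [pairing]

theorem dispersion_zero {μ : ℝ} (hμ2 : μ < 2) :
    dispersion μ (0 : Site n) = kinetic μ (0 : Site n) := by
  rw [dispersion, pairing_zero, norm_zero, zero_pow two_ne_zero, add_zero, Real.sqrt_sq]
  rw [kinetic_zero]; linarith

theorem dispersion_add_kinetic_pos (hn : Odd n) {μ : ℝ} (hμ2 : μ < 2) (k : Site n) :
    0 < dispersion μ k + kinetic μ k := by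
  by_cases hk : k = 0
  · rw [hk, dispersion_zero hμ2, kinetic_zero]; linarith
  · have h1 := one_le_norm_pairing hn hk
    have h2 : 0 < ‖pairing k‖ ^ 2 := by
      by_contra h
      have : ‖pairing k‖ ^ 2 = 0 := le_antisymm (not_lt.1 h) (sq_nonneg _)
      rw [this] at h1; norm_num at h1
    have h3 : |kinetic μ k| < dispersion μ k := by
      rw [dispersion, Real.lt_sqrt (abs_nonneg _), sq_abs]
      linarith
    have := neg_abs_le (kinetic μ k)
    linarith

theorem dispersion_sub_mul_add (μ : ℝ) (k : Site n) :
    (dispersion μ k - kinetic μ k) * (dispersion μ k + kinetic μ k) = ‖pairing k‖ ^ 2 := by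
  have := dispersion_sq μ k
  linear_combination this

end Dispersion

/-! ### Diagonalization of the Hamiltonian -/

section Hamiltonian

variable {n : ℕ} [NeZero n]

theorem sum_hop (v : Site n) : ∑ x : Site n, create (x + v) * annihilate x
    = ∑ k, wave (-k) v • (momCreate k * LinearMap.adjoint (momCreate k)) := by
  have h := sum_wave_mul v (create (V := Site n)) annihilate
  simp only [adjoint_momCreate]
  simp only [momCreate, smul_mul_smul_comm, smul_comm _ ((n : ℂ)⁻¹ * (n : ℂ)⁻¹)]
  rw [← Finset.smul_sum, h, smul_smul, ← sq, ← mul_pow, inv_mul_cancel₀ natCast_ne_zero, one_pow,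
    one_smul]

theorem sum_pair (v : Site n) : ∑ x : Site n, create (x + v) * create x
    = ∑ k, wave (-k) v • (momCreate k * momCreate (-k)) := by
  have h := sum_wave_mul v (create (V := Site n)) create
  simp only [momCreate, smul_mul_smul_comm, smul_comm _ ((n : ℂ)⁻¹ * (n : ℂ)⁻¹)]
  rw [← Finset.smul_sum, h, smul_smul, ← sq, ← mul_pow, inv_mul_cancel₀ natCast_ne_zero, one_pow,
    one_smul]

theorem wave_fst (k : Site n) : wave k (1, 0) = ZMod.stdAddChar k.1 := by simp [wave]

theorem wave_snd (k : Site n) : wave k (0, 1) = ZMod.stdAddChar k.2 := by simp [wave]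

/-- Only the odd part of a pairing amplitude matters. -/
theorem sum_smul_anticomm {A : Type*} [Ring A] [Algebra ℂ A] {e : Site n → A}
    (he : ∀ k l, e k * e l = -(e l * e k)) (f : Site n → ℂ) :
    ∑ k, f k • (e k * e (-k)) = ∑ k, ((f k - f (-k)) / 2) • (e k * e (-k)) := by
  have h : ∑ k, f k • (e k * e (-k)) = ∑ k, -(f (-k) • (e k * e (-k))) := by
    rw [← Equiv.sum_comp (Equiv.neg (Site n))]
    refine Finset.sum_congr rfl fun k _ => ?_
    rw [Equiv.neg_apply, neg_neg, he, smul_neg]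
  have h2 : (2 : ℂ) • ∑ k, f k • (e k * e (-k))
      = (2 : ℂ) • ∑ k, ((f k - f (-k)) / 2) • (e k * e (-k)) := by
    rw [two_smul]
    nth_rewrite 2 [h]
    rw [← Finset.sum_add_distrib, Finset.smul_sum]
    refine Finset.sum_congr rfl fun k _ => ?_
    module
  exact smul_right_injective _ (two_ne_zero (α := ℂ)) h2

/-- The Hamiltonian in momentum space. -/
theorem hamiltonian_eq_sum (μ : ℝ) : hamiltonian n μ
    = ∑ k : Site n, ((kinetic μ k : ℂ) • (momCreate k * LinearMap.adjoint (momCreate k))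
      + (pairing k / 2) • (momCreate k * momCreate (-k))
      + ((starRingEnd ℂ) (pairing k) / 2) •
        (LinearMap.adjoint (momCreate (-k)) * LinearMap.adjoint (momCreate k))) := by
  have hpair : ∑ x : Site n, (create (x + (1, 0)) * create x
      + Complex.I • (create (x + (0, 1)) * create x))
      = ∑ k : Site n, (pairing k / 2) • (momCreate k * momCreate (-k)) := by
    rw [Finset.sum_add_distrib, ← Finset.smul_sum, sum_pair, sum_pair, Finset.smul_sum,
      ← Finset.sum_add_distrib]
    simp only [smul_smul, ← add_smul]
    rw [sum_smul_anticomm isModes_momCreate.anticomm]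
    refine Finset.sum_congr rfl fun k _ => congrArg (· • _) ?_
    rw [neg_neg, wave_neg_left, wave_neg_left]
    simp only [wave_fst, wave_snd, pairing]
    apply Complex.ext <;> simp <;> ring
  have hhop : ∑ x : Site n, (create (x + (1, 0)) * annihilate x + create (x + (0, 1)) * annihilate x)
      = ∑ k : Site n, ((starRingEnd ℂ) (ZMod.stdAddChar k.1) + (starRingEnd ℂ) (ZMod.stdAddChar k.2)) •
        (momCreate k * LinearMap.adjoint (momCreate k)) := by
    rw [Finset.sum_add_distrib, sum_hop, sum_hop, ← Finset.sum_add_distrib]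
    simp only [← add_smul, wave_neg_left]
    simp only [wave_fst, wave_snd]
  have hnum : ∑ x : Site n, create x * annihilate x
      = ∑ k : Site n, momCreate k * LinearMap.adjoint (momCreate k) := by
    simpa [wave_zero_right] using sum_hop (0 : Site n)
  have hhp : hoppingPairing n = ∑ k : Site n,
      (((starRingEnd ℂ) (ZMod.stdAddChar k.1) + (starRingEnd ℂ) (ZMod.stdAddChar k.2)) •
        (momCreate k * LinearMap.adjoint (momCreate k))
        + (pairing k / 2) • (momCreate k * momCreate (-k))) := by
    rw [Finset.sum_add_distrib, ← hhop, ← hpair, ← Finset.sum_add_distrib, hoppingPairing]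
    refine Finset.sum_congr rfl fun x _ => ?_
    abel
  rw [hamiltonian, hnum, hhp, map_sum, Finset.smul_sum, ← Finset.sum_add_distrib,
    ← Finset.sum_sub_distrib]
  refine Finset.sum_congr rfl fun k _ => ?_
  simp only [map_add, map_smulₛₗ, adjoint_mul, LinearMap.adjoint_adjoint, Complex.conj_conj,
    map_div₀, map_ofNat]
  have : (kinetic μ k : ℂ) = (starRingEnd ℂ) (ZMod.stdAddChar k.1)
      + (starRingEnd ℂ) (ZMod.stdAddChar k.2)
      + (ZMod.stdAddChar k.1 + ZMod.stdAddChar k.2) - 2 * μ := by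
    apply Complex.ext <;> simp [kinetic] <;> ring
  rw [this]
  module

/-- The ground state energy. -/
def groundEnergy (n : ℕ) [NeZero n] (μ : ℝ) : ℝ :=
  -∑ k : Site n, (dispersion μ k - kinetic μ k) / 2

theorem hamiltonian_diagonal (hn : Odd n) {μ : ℝ} (hμ2 : μ < 2) : hamiltonian n μ
    = (groundEnergy n μ : ℂ) • (1 : Module.End ℂ (Fock (Site n)))
      + ∑ k : Site n, ((dispersion μ k + kinetic μ k : ℝ) / 2 : ℂ) •
        (LinearMap.adjoint (quasi momCreate (pairAmplitude μ) k)
          * quasi momCreate (pairAmplitude μ) k) := by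
  have hk : ∀ k : Site n, ((dispersion μ k + kinetic μ k : ℝ) / 2 : ℂ) •
        (LinearMap.adjoint (quasi momCreate (pairAmplitude μ) k)
          * quasi momCreate (pairAmplitude μ) k)
      = ((dispersion μ k - kinetic μ k) / 2 : ℂ) • (1 : Module.End ℂ (Fock (Site n)))
        + (((dispersion μ k + kinetic μ k) / 2 : ℂ) • (momCreate k * LinearMap.adjoint (momCreate k))
        + (pairing k / 2) • (momCreate k * momCreate (-k))
        + ((starRingEnd ℂ) (pairing k) / 2) •
        (LinearMap.adjoint (momCreate (-k)) * LinearMap.adjoint (momCreate k))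
        - ((dispersion μ k - kinetic μ k) / 2 : ℂ) •
          (momCreate (-k) * LinearMap.adjoint (momCreate (-k)))) := by
    intro k
    have hpos := dispersion_add_kinetic_pos hn hμ2 k
    have hne : ((dispersion μ k + kinetic μ k : ℝ) : ℂ) ≠ 0 := by exact_mod_cast hpos.ne'
    have h1 : ((dispersion μ k + kinetic μ k : ℝ) : ℂ) * pairAmplitude μ k = -pairing k := by
      rw [pairAmplitude]; field_simp
    have h2 : ((dispersion μ k + kinetic μ k : ℝ) : ℂ) * (starRingEnd ℂ) (pairAmplitude μ k)
        = -(starRingEnd ℂ) (pairing k) := by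
      rw [← map_neg, ← h1, map_mul, Complex.conj_ofReal]
    have h3 : ((dispersion μ k + kinetic μ k : ℝ) : ℂ) *
        ((starRingEnd ℂ) (pairAmplitude μ k) * pairAmplitude μ k) = dispersion μ k - kinetic μ k := by
      have h4 := dispersion_sub_mul_add μ k
      have h5 : (starRingEnd ℂ) (pairing k) * pairing k = ((‖pairing k‖ ^ 2 : ℝ) : ℂ) := by
        rw [mul_comm, Complex.mul_conj, Complex.normSq_eq_norm_sq]
      apply mul_left_cancel₀ hne
      calc ((dispersion μ k + kinetic μ k : ℝ) : ℂ) * (((dispersion μ k + kinetic μ k : ℝ) : ℂ) *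
            ((starRingEnd ℂ) (pairAmplitude μ k) * pairAmplitude μ k))
          = (((dispersion μ k + kinetic μ k : ℝ) : ℂ) * (starRingEnd ℂ) (pairAmplitude μ k)) *
            (((dispersion μ k + kinetic μ k : ℝ) : ℂ) * pairAmplitude μ k) := by ring
        _ = _ := by rw [h2, h1, neg_mul_neg, h5, ← h4]; push_cast; ring
    have h4 := (isModes_momCreate (n := n)).car (-k) (-k)
    rw [if_pos rfl] at h4
    rw [adjoint_quasi, quasi]
    simp only [mul_sub, sub_mul, smul_mul_assoc, mul_smul_comm, smul_smul, smul_sub,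
      eq_sub_of_add_eq h4]
    push_cast at h1 h2 h3 ⊢
    linear_combination (norm := module) (-1 / 2 : ℂ) • h1 • (momCreate k * momCreate (-k))
      + (-1 / 2 : ℂ) • h2 • (LinearMap.adjoint (momCreate (-k)) * LinearMap.adjoint (momCreate k))
      + (1 / 2 : ℂ) • h3 • ((1 : Module.End ℂ (Fock (Site n)))
        - momCreate (-k) * LinearMap.adjoint (momCreate (-k)))
  rw [hamiltonian_eq_sum, Finset.sum_congr rfl fun k _ => hk k]
  have h5 : ∑ k : Site n, ((dispersion μ k - kinetic μ k) / 2 : ℂ) •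
          (momCreate (-k) * LinearMap.adjoint (momCreate (-k)))
      = ∑ k : Site n, ((dispersion μ k - kinetic μ k) / 2 : ℂ) •
          (momCreate k * LinearMap.adjoint (momCreate k)) := by
    rw [← Equiv.sum_comp (Equiv.neg (Site n))]
    simp [dispersion_neg, kinetic_neg]
  conv_rhs => rw [Finset.sum_add_distrib, Finset.sum_sub_distrib, h5, ← Finset.sum_sub_distrib,
    ← add_assoc, ← Finset.sum_smul, ← add_smul]
  have h6 : (groundEnergy n μ : ℂ) + ∑ k : Site n, ((dispersion μ k - kinetic μ k) / 2 : ℂ) = 0 := by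
    simp [groundEnergy]
  rw [h6, zero_smul, zero_add]
  refine Finset.sum_congr rfl fun k _ => ?_
  module

/-- The ground state of the superconductor is the vacuum of the quasiparticles, and it is unique. -/
theorem exists_unique_ground_state (hn : Odd n) {μ : ℝ} (hμ2 : μ < 2) :
    ∃ ψ : Fock (Site n), IsGroundState (hamiltonian n μ) ψ ∧
      (∀ ψ', IsGroundState (hamiltonian n μ) ψ' → ∃ c : ℂ, ψ' = c • ψ) ∧
      ∀ χ, (∀ k, quasi momCreate (pairAmplitude μ) k χ = 0) → ∃ c : ℂ, χ = c • ψ := by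
  obtain ⟨ψ, h1, h2, h3⟩ := isModes_momCreate.exists_quasi_vacuum (pairAmplitude_neg (n := n) μ)
  have hH := hamiltonian_diagonal hn hμ2
  have hψ : hamiltonian n μ ψ = (groundEnergy n μ : ℂ) • ψ := by
    rw [hH]
    simp [h2]
  have hE : ∀ (χ : Fock (Site n)) (E : ℝ), hamiltonian n μ χ = (E : ℂ) • χ →
      ∑ k : Site n, (dispersion μ k + kinetic μ k) / 2 * ‖quasi momCreate (pairAmplitude μ) k χ‖ ^ 2
        = (E - groundEnergy n μ) * ‖χ‖ ^ 2 := by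
    intro χ E hχ
    have h4 := congrArg (fun φ => ⟪χ, φ⟫_ℂ) hχ
    simp only [hH, LinearMap.add_apply, LinearMap.smul_apply, Module.End.one_apply,
      LinearMap.sum_apply, Module.End.mul_apply, inner_add_right, inner_smul_right, inner_sum,
      LinearMap.adjoint_inner_right, inner_self_eq_norm_sq_to_K] at h4
    rw [← Complex.ofReal_inj]
    push_cast at h4 ⊢
    rw [sub_mul]
    exact eq_sub_of_add_eq' h4
  have hnonneg : ∀ χ : Fock (Site n), ∀ k ∈ Finset.univ, 0 ≤
      (dispersion μ k + kinetic μ k) / 2 * ‖quasi momCreate (pairAmplitude μ) k χ‖ ^ 2 :=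
    fun χ k _ => mul_nonneg (half_pos (dispersion_add_kinetic_pos hn hμ2 k)).le (sq_nonneg _)
  refine ⟨ψ, ⟨h1, groundEnergy n μ, hψ, fun E hE' => ?_⟩, fun ψ' ⟨hn', E, hE1, hE2⟩ => ?_, h3⟩
  · obtain ⟨χ, hχ, hχ0⟩ := hE'.exists_hasEigenvector
    have h5 := hE χ E (Module.End.mem_eigenspace_iff.1 hχ)
    have h6 := Finset.sum_nonneg (hnonneg χ)
    rw [h5] at h6
    have h7 : 0 < ‖χ‖ ^ 2 := by have := norm_pos_iff.2 hχ0; positivity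
    linarith [nonneg_of_mul_nonneg_left h6 h7]
  · apply h3
    have h4 : E ≤ groundEnergy n μ := hE2 _ <| Module.End.hasEigenvalue_of_hasEigenvector
      (x := ψ) ⟨Module.End.mem_eigenspace_iff.2 hψ, fun h0 => by simp [h0] at h1⟩
    have h5 := hE ψ' E hE1
    have h6 : ∑ k : Site n, (dispersion μ k + kinetic μ k) / 2 *
        ‖quasi momCreate (pairAmplitude μ) k ψ'‖ ^ 2 = 0 := by
      refine le_antisymm ?_ (Finset.sum_nonneg (hnonneg ψ'))
      rw [h5]
      exact mul_nonpos_of_nonpos_of_nonneg (by linarith) (sq_nonneg _)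
    intro k
    have h7 := (Finset.sum_eq_zero_iff_of_nonneg (hnonneg ψ')).1 h6 k (Finset.mem_univ _)
    have h8 := (dispersion_add_kinetic_pos hn hμ2 k).ne'
    simpa [h8] using h7

end Hamiltonian

/-! ### Berezin integrals -/

section Berezin

theorem contractLeft_mem_pow {M : Type*} [AddCommGroup M] [Module ℂ M] (d : Module.Dual ℂ M) :
    ∀ (e : ℕ) (y : ExteriorAlgebra ℂ M), y ∈ LinearMap.range (ExteriorAlgebra.ι ℂ (M := M)) ^ (e + 1) →
      CliffordAlgebra.contractLeft d y ∈ LinearMap.range (ExteriorAlgebra.ι ℂ (M := M)) ^ e := by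
  intro e
  induction e with
  | zero =>
    intro y hy
    rw [zero_add, pow_one] at hy
    obtain ⟨v, rfl⟩ := hy
    rw [pow_zero, ExteriorAlgebra.ι, CliffordAlgebra.contractLeft_ι]
    exact Submodule.algebraMap_mem _
  | succ e ih =>
    intro y hy
    rw [pow_succ'] at hy
    refine Submodule.mul_induction_on hy ?_ fun y z hy hz => by rw [map_add]; exact add_mem hy hz
    rintro _ ⟨v, rfl⟩ z hz
    rw [ExteriorAlgebra.ι, CliffordAlgebra.contractLeft_ι_mul]
    refine sub_mem (Submodule.smul_mem _ _ hz) ?_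
    rw [pow_succ']
    exact Submodule.mul_mem_mul ⟨v, rfl⟩ (ih z hz)

namespace FermionicNetwork

variable {n : ℕ} (N : FermionicNetwork n)

theorem berezin_berezin (j k : N.Neuron) (f : N.Grassmann) :
    N.berezin j (N.berezin k f) = -N.berezin k (N.berezin j f) :=
  CliffordAlgebra.contractLeft_comm _ _ _

theorem berezin_berezin_self (j : N.Neuron) (f : N.Grassmann) :
    N.berezin j (N.berezin j f) = 0 :=
  CliffordAlgebra.contractLeft_contractLeft _ _

theorem berezin_one (j : N.Neuron) : N.berezin j 1 = 0 :=
  CliffordAlgebra.contractLeft_one _ _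

theorem berezin_xi_mul (j k : N.Neuron) (f : N.Grassmann) :
    N.berezin j (N.xi k * f) = (if j = k then f else 0) - N.xi k * N.berezin j f := by
  have h := CliffordAlgebra.contractLeft_ι_mul (Q := (0 : QuadraticForm ℂ (N.Neuron → ℂ)))
    (LinearMap.proj j : Module.Dual ℂ (N.Neuron → ℂ)) (Pi.single k 1) f
  refine h.trans ?_
  rw [LinearMap.proj_apply, Pi.single_apply, ite_smul, one_smul, zero_smul]
  rfl

theorem xi_mul_xi (j k : N.Neuron) : N.xi j * N.xi k = -(N.xi k * N.xi j) :=
  eq_neg_of_add_eq_zero_left (ExteriorAlgebra.ι_add_mul_swap _ _)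

/-- The iterated Berezin integral over the hidden units in a list. -/
def berezinList (l : List (Fin N.numHidden)) : N.Grassmann →ₗ[ℂ] N.Grassmann :=
  l.foldr (fun h g => N.berezin (Sum.inr h) ∘ₗ g) LinearMap.id

theorem berezinList_cons (a : Fin N.numHidden) (l : List (Fin N.numHidden)) (f : N.Grassmann) :
    N.berezinList (a :: l) f = N.berezin (Sum.inr a) (N.berezinList l f) := rfl

theorem integrateHidden_eq (f : N.Grassmann) :
    N.integrateHidden f = N.berezinList (List.finRange N.numHidden) f := by
  rw [integrateHidden]
  induction List.finRange N.numHidden with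
  | nil => rfl
  | cons a l ih => rw [List.foldr_cons, ih, berezinList_cons]

theorem berezinList_berezin (l : List (Fin N.numHidden)) (j : N.Neuron) (f : N.Grassmann) :
    N.berezinList l (N.berezin j f) = (-1 : ℂ) ^ l.length • N.berezin j (N.berezinList l f) := by
  induction l with
  | nil => simp [berezinList]
  | cons a l ih =>
    rw [berezinList_cons, ih, map_smul, berezin_berezin, berezinList_cons, List.length_cons, pow_succ]
    module

theorem berezinList_berezin_of_mem {l : List (Fin N.numHidden)} {h : Fin N.numHidden} (hl : h ∈ l)
    (f : N.Grassmann) : N.berezinList l (N.berezin (Sum.inr h) f) = 0 := by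
  induction l with
  | nil => simp at hl
  | cons a l ih =>
    rw [berezinList_cons]
    rcases List.mem_cons.1 hl with rfl | hl
    · rw [berezinList_berezin, map_smul, berezin_berezin_self, smul_zero]
    · rw [ih hl, map_zero]

theorem berezinList_xi_mul (l : List (Fin N.numHidden)) (x : Site n) (f : N.Grassmann) :
    N.berezinList l (N.xi (Sum.inl x) * f)
      = (-1 : ℂ) ^ l.length • (N.xi (Sum.inl x) * N.berezinList l f) := by
  induction l with
  | nil => simp [berezinList]
  | cons a l ih =>
    rw [berezinList_cons, ih, map_smul, berezin_xi_mul, if_neg (by simp), berezinList_cons,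
      List.length_cons, pow_succ]
    module

theorem exists_berezinList_eq {l : List (Fin N.numHidden)} (hl : l.Nodup) :
    ∀ z : N.Grassmann, (∀ h ∈ l, N.berezin (Sum.inr h) z = 0) → ∃ y, N.berezinList l y = z := by
  induction l with
  | nil => exact fun z _ => ⟨z, rfl⟩
  | cons a l ih =>
    intro z hz
    rw [List.nodup_cons] at hl
    obtain ⟨y, hy⟩ := ih hl.2 (N.xi (Sum.inr a) * z) fun h hh => by
      rw [berezin_xi_mul, if_neg, hz h (List.mem_cons_of_mem _ hh), mul_zero, sub_zero]
      rintro ⟨⟩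
      exact hl.1 hh
    refine ⟨y, ?_⟩
    rw [berezinList_cons, hy, berezin_xi_mul, if_pos rfl, hz a List.mem_cons_self, mul_zero, sub_zero]

variable [NeZero n]

theorem substLinear_apply (v : N.Neuron → ℂ) :
    N.substLinear v = ∑ x : Site n, v (Sum.inl x) • create x := by
  simp [substLinear]

theorem subst_ι_mul (v : N.Neuron → ℂ) (f : N.Grassmann) :
    N.subst (ExteriorAlgebra.ι ℂ v * f) = N.substLinear v * N.subst f := by
  rw [map_mul, subst, ExteriorAlgebra.lift_ι_apply]

theorem subst_xi_mul (x : Site n) (f : N.Grassmann) :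
    N.subst (N.xi (Sum.inl x) * f) = create x * N.subst f := by
  rw [xi, subst_ι_mul, substLinear_apply]
  simp [Pi.single_apply]

theorem subst_berezin (x : Site n) (f : N.Grassmann) :
    N.subst (N.berezin (Sum.inl x) f) vacuum = annihilate x (N.subst f vacuum) := by
  refine CliffordAlgebra.left_induction (Q := (0 : QuadraticForm ℂ (N.Neuron → ℂ)))
    (P := fun f => N.subst (N.berezin (Sum.inl x) f) vacuum = annihilate x (N.subst f vacuum))
    (fun r => ?_) (fun f g hf hg => ?_) (fun f v hf => ?_) f
  · have h1 : N.subst (algebraMap ℂ N.Grassmann r) = algebraMap ℂ _ r := AlgHom.commutes _ _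
    rw [berezin, CliffordAlgebra.contractLeft_algebraMap]
    refine Eq.trans ?_ (congrArg (fun T : Module.End ℂ (Fock (Site n)) => annihilate x (T vacuum)) h1.symm)
    rw [Module.algebraMap_end_apply, map_smul, annihilate_vacuum, smul_zero, map_zero,
      LinearMap.zero_apply]
  · simp only [map_add, LinearMap.add_apply, hf, hg]
  · have h1 : annihilate x * N.substLinear v
        = v (Sum.inl x) • (1 : Module.End ℂ (Fock (Site n))) - N.substLinear v * annihilate x := by
      rw [eq_sub_iff_add_eq, substLinear_apply]
      simp only [Finset.mul_sum, Finset.sum_mul, mul_smul_comm, smul_mul_assoc,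
        ← Finset.sum_add_distrib, ← smul_add, annihilate_mul_create]
      simp
    have h2 : N.berezin (Sum.inl x) (ExteriorAlgebra.ι ℂ v * f)
        = v (Sum.inl x) • f - ExteriorAlgebra.ι ℂ v * N.berezin (Sum.inl x) f :=
      CliffordAlgebra.contractLeft_ι_mul _ _ _
    change N.subst (N.berezin (Sum.inl x) (ExteriorAlgebra.ι ℂ v * f)) vacuum
      = annihilate x (N.subst (ExteriorAlgebra.ι ℂ v * f) vacuum)
    have h3 := congrArg (fun T : Module.End ℂ (Fock (Site n)) => T (N.subst f vacuum)) h1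
    simp only [Module.End.mul_apply, LinearMap.sub_apply, LinearMap.smul_apply,
      Module.End.one_apply] at h3
    rw [h2, map_sub, subst_ι_mul, subst_ι_mul, map_smul, LinearMap.sub_apply, Module.End.mul_apply,
      Module.End.mul_apply, hf, LinearMap.smul_apply, h3]

/-- Integrating out the hidden units and applying the resulting polynomial to the vacuum. -/
def readout : N.Grassmann →ₗ[ℂ] Fock (Site n) :=
  LinearMap.applyₗ vacuum ∘ₗ N.subst.toLinearMap ∘ₗ N.berezinList (List.finRange N.numHidden)

theorem readout_apply (f : N.Grassmann) : N.readout f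
    = N.subst (N.berezinList (List.finRange N.numHidden) f) vacuum := rfl

theorem readout_berezin_hidden (h : Fin N.numHidden) (f : N.Grassmann) :
    N.readout (N.berezin (Sum.inr h) f) = 0 := by
  rw [readout_apply, berezinList_berezin_of_mem _ (List.mem_finRange h), map_zero,
    LinearMap.zero_apply]

theorem readout_berezin_visible (x : Site n) (f : N.Grassmann) :
    N.readout (N.berezin (Sum.inl x) f) = (-1 : ℂ) ^ N.numHidden • annihilate x (N.readout f) := by
  rw [readout_apply, berezinList_berezin, map_smul, LinearMap.smul_apply, subst_berezin,
    List.length_finRange, readout_apply]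

theorem readout_xi_visible_mul (x : Site n) (f : N.Grassmann) :
    N.readout (N.xi (Sum.inl x) * f) = (-1 : ℂ) ^ N.numHidden • create x (N.readout f) := by
  rw [readout_apply, berezinList_xi_mul, map_smul, LinearMap.smul_apply, subst_xi_mul,
    List.length_finRange, readout_apply, Module.End.mul_apply]

theorem readout_ne_zero : N.readout ≠ 0 := by
  intro h0
  obtain ⟨y, hy⟩ := N.exists_berezinList_eq (List.nodup_finRange _) 1 fun h _ => N.berezin_one _
  have : N.readout y = vacuum := by rw [readout_apply, hy, map_one, Module.End.one_apply]
  rw [h0] at this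
  exact vacuum_ne_zero this.symm

/-- The Grassmann exponential of the network. -/
def boltzmann : N.Grassmann := IsNilpotent.exp (-N.energy)

theorem unnormalizedState_eq : N.unnormalizedState = N.readout N.boltzmann := by
  rw [unnormalizedState, integrateHidden_eq]; rfl

theorem isNilpotent_energy : IsNilpotent N.energy :=
  isNilpotent_quadratic N.xi_mul_xi _

theorem commute_energy_xi (k : N.Neuron) : Commute N.energy (N.xi k) :=
  commute_quadratic N.xi_mul_xi _ k

theorem berezin_energy_mul (j : N.Neuron) (f : N.Grassmann) : N.berezin j (N.energy * f)
    = (∑ k, (N.weight j k - N.weight k j) • N.xi k) * f + N.energy * N.berezin j f := by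
  have h : ∀ a b, N.berezin j (N.xi a * N.xi b * f)
      = (if j = a then N.xi b * f else 0) - (if j = b then N.xi a * f else 0)
        + N.xi a * N.xi b * N.berezin j f := by
    intro a b
    rw [mul_assoc, berezin_xi_mul, berezin_xi_mul, mul_sub, mul_ite, mul_zero]
    split_ifs <;> noncomm_ring
  simp only [energy, Finset.sum_mul, smul_mul_assoc, map_sum, map_smul, h, smul_add, smul_sub,
    Finset.sum_add_distrib, Finset.sum_sub_distrib, smul_ite, smul_zero, sub_smul, sub_mul]
  rw [Finset.sum_comm (f := fun a b => if j = a then N.weight a b • (N.xi b * f) else 0)]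
  simp only [Finset.sum_ite_eq, Finset.mem_univ, if_true]

theorem commute_boltzmann_xi (k : N.Neuron) : Commute N.boltzmann (N.xi k) := by
  rw [boltzmann, IsNilpotent.exp]
  refine Commute.sum_left _ _ _ fun i _ => ?_
  exact ((N.commute_energy_xi k).neg_left.pow_left i).smul_left _

theorem berezin_boltzmann_mul (j : N.Neuron) (f : N.Grassmann) : N.berezin j (N.boltzmann * f)
    = N.boltzmann * (N.berezin j f - (∑ k, (N.weight j k - N.weight k j) • N.xi k) * f) := by
  set L := ∑ k, (N.weight j k - N.weight k j) • N.xi k with hL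
  have hc : Commute N.energy L :=
    Commute.sum_right _ _ _ fun k _ => (N.commute_energy_xi k).smul_right _
  have hc' : Commute N.boltzmann L :=
    Commute.sum_right _ _ _ fun k _ => (N.commute_boltzmann_xi k).smul_right _
  have := map_exp_mul (a := -N.energy) (b := -L) hc.neg_left.neg_right N.isNilpotent_energy.neg
    (N.berezin j).toAddMonoidHom (fun y => ?_) f
  · refine Eq.trans this ?_
    change -L * (N.boltzmann * f) + N.boltzmann * N.berezin j f = _
    rw [mul_sub, ← mul_assoc, ← mul_assoc, hc'.eq]
    noncomm_ring
  · change N.berezin j (-N.energy * y) = -L * y + -N.energy * N.berezin j y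
    rw [neg_mul, map_neg, berezin_energy_mul, ← hL, neg_mul, neg_mul, neg_add]

theorem isUnit_boltzmann : IsUnit N.boltzmann :=
  IsNilpotent.isUnit_exp N.isNilpotent_energy.neg

/-- The equations for the moments of the hidden units. -/
theorem sum_readout_hidden (h : Fin N.numHidden) (f : N.Grassmann) :
    ∑ h', (N.weight (Sum.inr h) (Sum.inr h') - N.weight (Sum.inr h') (Sum.inr h)) •
        N.readout (N.boltzmann * (N.xi (Sum.inr h') * f))
      + (-1 : ℂ) ^ N.numHidden • ∑ x,
        (N.weight (Sum.inr h) (Sum.inl x) - N.weight (Sum.inl x) (Sum.inr h)) •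
          create x (N.readout (N.boltzmann * f))
      = N.readout (N.boltzmann * N.berezin (Sum.inr h) f) := by
  have h1 := N.readout_berezin_hidden h (N.boltzmann * f)
  have h2 : ∀ x, N.readout (N.boltzmann * (N.xi (Sum.inl x) * f))
      = (-1 : ℂ) ^ N.numHidden • create x (N.readout (N.boltzmann * f)) := fun x => by
    rw [← mul_assoc, (N.commute_boltzmann_xi _).eq, mul_assoc, readout_xi_visible_mul]
  rw [berezin_boltzmann_mul, mul_sub, map_sub, sub_eq_zero] at h1
  rw [h1, Fintype.sum_sum_type, add_mul, mul_add, map_add, add_comm]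
  simp only [Finset.sum_mul, Finset.mul_sum, map_sum, smul_mul_assoc, mul_smul_comm, map_smul, h2,
    Finset.smul_sum]
  congr 1
  exact Finset.sum_congr rfl fun x _ => smul_comm _ _ _

/-- The annihilation operators act on the state through the moments of the hidden units. -/
theorem annihilate_readout (hvv : ∀ x y, N.weight (Sum.inl x) (Sum.inl y) = 0) (x : Site n) :
    (-1 : ℂ) ^ N.numHidden • annihilate x (N.readout N.boltzmann)
      = -∑ h, (N.weight (Sum.inl x) (Sum.inr h) - N.weight (Sum.inr h) (Sum.inl x)) •
        N.readout (N.boltzmann * N.xi (Sum.inr h)) := by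
  have h1 := N.readout_berezin_visible x (N.boltzmann * 1)
  rw [berezin_boltzmann_mul, berezin_one, zero_sub, mul_one, mul_one, Fintype.sum_sum_type] at h1
  rw [← h1]
  simp [hvv, Finset.mul_sum]

/-- The state of a network with nondegenerate hidden couplings does not vanish. -/
theorem unnormalizedState_ne_zero
    (hinj : ∀ r : Fin N.numHidden → Fock (Site n),
      (∀ h, ∑ h', (N.weight (Sum.inr h) (Sum.inr h') - N.weight (Sum.inr h') (Sum.inr h)) • r h' = 0) →
        r = 0) : N.unnormalizedState ≠ 0 := by
  intro h0
  rw [unnormalizedState_eq] at h0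
  have key : ∀ (d : ℕ) (y : N.Grassmann),
      y ∈ LinearMap.range (ExteriorAlgebra.ι ℂ (M := N.Neuron → ℂ)) ^ d →
        N.readout (N.boltzmann * y) = 0 := by
    intro d
    induction d using Nat.strong_induction_on with
    | _ d ih =>
      intro y hy
      rcases d with _ | d
      · rw [pow_zero] at hy
        obtain ⟨c, rfl⟩ := Submodule.mem_one.1 hy
        rw [Algebra.algebraMap_eq_smul_one, mul_smul_comm, mul_one, map_smul, h0, smul_zero]
      rw [pow_succ'] at hy
      refine Submodule.mul_induction_on hy ?_ fun y z hy hz => by rw [mul_add, map_add, hy, hz, add_zero]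
      rintro _ ⟨v, rfl⟩ z hz
      have hz0 := ih d (Nat.lt_succ_self d) z hz
      have hvis : ∀ x, N.readout (N.boltzmann * (N.xi (Sum.inl x) * z)) = 0 := fun x => by
        rw [← mul_assoc, (N.commute_boltzmann_xi _).eq, mul_assoc, readout_xi_visible_mul, hz0,
          map_zero, smul_zero]
      have hdz : ∀ h, N.readout (N.boltzmann * N.berezin (Sum.inr h) z) = 0 := fun h => by
        rcases d with _ | d
        · rw [pow_zero] at hz
          obtain ⟨c, rfl⟩ := Submodule.mem_one.1 hz
          rw [Algebra.algebraMap_eq_smul_one, map_smul, berezin_one, smul_zero, mul_zero, map_zero]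
        · exact ih d (by omega) _ (contractLeft_mem_pow _ d z hz)
      have hhid := hinj (fun h => N.readout (N.boltzmann * (N.xi (Sum.inr h) * z))) fun h => by
        have := N.sum_readout_hidden h z
        simpa only [hz0, hdz, map_zero, smul_zero, Finset.sum_const_zero, add_zero] using this
      have hv : ExteriorAlgebra.ι ℂ v = ∑ j, v j • N.xi j := by
        conv_lhs => rw [pi_eq_sum_univ' v]
        simp only [map_sum, map_smul, xi, Pi.single]
      rw [hv, Finset.sum_mul, Finset.mul_sum, map_sum]
      refine Finset.sum_eq_zero fun j _ => ?_
      rw [smul_mul_assoc, mul_smul_comm, map_smul]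
      rcases j with x | h
      · rw [hvis, smul_zero]
      · rw [congrFun hhid h, Pi.zero_apply, smul_zero]
  have hall : ∀ y : N.Grassmann, N.readout (N.boltzmann * y) = 0 := fun y => by
    refine DirectSum.Decomposition.inductionOn (fun i => ⋀[ℂ]^i (N.Neuron → ℂ)) ?_ ?_ ?_ y
    · simp
    · exact fun {i} m => key i m m.2
    · exact fun a b ha hb => by rw [mul_add, map_add, ha, hb, add_zero]
  apply N.readout_ne_zero
  refine LinearMap.ext fun y => ?_
  obtain ⟨u, hu⟩ := N.isUnit_boltzmann
  have := hall (↑u⁻¹ * y)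
  rwa [← mul_assoc, ← hu, Units.mul_inv, one_mul] at this

end FermionicNetwork

end Berezin

/-! ### Discrete Fourier analysis of the network equations -/

section Fourier

variable {n : ℕ} [NeZero n]

/-- The Fourier transform on the torus. -/
def latticeFourier (f : Site n → ℂ) (k : Site n) : ℂ := ∑ d, wave k d * f d

variable {F : Type*} [AddCommGroup F] [Module ℂ F]

theorem latticeFourier_zero (f : Site n → ℂ) : latticeFourier f 0 = ∑ d, f d := by
  simp [latticeFourier, wave_zero_left]

theorem latticeFourier_comp_neg (f : Site n → ℂ) (k : Site n) :
    latticeFourier (fun d => f (-d)) k = latticeFourier f (-k) := by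
  rw [latticeFourier, latticeFourier, ← Equiv.sum_comp (Equiv.neg (Site n))]
  simp [wave_neg_right]

/-- The Fourier transform turns convolution into multiplication. -/
theorem sum_wave_smul_conv (γ : Site n → ℂ) (r : Site n → F) (k : Site n) :
    ∑ h, wave k h • ∑ y, γ (y - h) • r y = latticeFourier γ (-k) • ∑ y, wave k y • r y := by
  simp only [Finset.smul_sum, smul_smul]
  rw [Finset.sum_comm]
  refine Finset.sum_congr rfl fun y _ => ?_
  rw [← Finset.sum_smul, latticeFourier, Finset.sum_mul, ← Equiv.sum_comp (Equiv.subLeft y)]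
  congr 1
  refine Finset.sum_congr rfl fun d _ => ?_
  rw [Equiv.subLeft_apply, sub_sub_cancel, sub_eq_add_neg, wave_add_right, wave_neg_right]
  ring

theorem sum_conv (γ : Site n → ℂ) (r : Site n → F) :
    ∑ h, ∑ y, γ (y - h) • r y = (∑ d, γ d) • ∑ y, r y := by
  simpa [wave_zero_left, latticeFourier_zero] using sum_wave_smul_conv γ r 0

theorem eq_of_fourier_eq_zero {r : Site n → F} (h : ∀ k, k ≠ 0 → ∑ y, wave k y • r y = 0)
    (x y : Site n) : r x = r y := by
  have h1 : ∀ x, (n : ℂ) ^ 2 • r x = ∑ y, r y := by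
    intro x
    calc (n : ℂ) ^ 2 • r x = ∑ y, ∑ k, wave k (y - x) • r y := by
          simp only [← Finset.sum_smul, sum_wave_left, sub_eq_zero, ite_smul, zero_smul]
          simp
      _ = ∑ k, wave k (-x) • ∑ y, wave k y • r y := by
          rw [Finset.sum_comm]
          refine Finset.sum_congr rfl fun k _ => ?_
          rw [Finset.smul_sum]
          refine Finset.sum_congr rfl fun y _ => ?_
          rw [smul_smul, ← wave_add_right, sub_eq_neg_add]
      _ = ∑ y, r y := by
          rw [Finset.sum_eq_single 0]
          · simp [wave_zero_left]
          · intro k _ hk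
            rw [h k hk, smul_zero]
          · simp
  have h2 : (n : ℂ) ^ 2 ≠ 0 := pow_ne_zero _ natCast_ne_zero
  exact smul_right_injective F h2 ((h1 x).trans (h1 y).symm)

/-- If the couplings have mean zero, the equations at all sites but one imply the remaining one. -/
theorem conv_eq_zero {γ α : Site n → ℂ} (hγ : ∑ d, γ d = 0) (hα : ∑ d, α d = 0) {r c : Site n → F}
    (h : ∀ x, x ≠ 0 → ∑ y, γ (y - x) • r y + ∑ y, α (y - x) • c y = 0) (x : Site n) :
    ∑ y, γ (y - x) • r y + ∑ y, α (y - x) • c y = 0 := by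
  by_cases hx : x = 0
  · have h1 : ∑ x, (∑ y, γ (y - x) • r y + ∑ y, α (y - x) • c y) = 0 := by
      rw [Finset.sum_add_distrib, sum_conv, sum_conv, hγ, hα, zero_smul, zero_smul, add_zero]
    rwa [Finset.sum_eq_single 0 (fun x _ hx => h x hx) (by simp), ← hx] at h1
  · exact h x hx

theorem latticeFourier_conv_eq_zero {γ α : Site n → ℂ} (hγ : ∑ d, γ d = 0) (hα : ∑ d, α d = 0)
    {r c : Site n → F}
    (h : ∀ x, x ≠ 0 → ∑ y, γ (y - x) • r y + ∑ y, α (y - x) • c y = 0) (k : Site n) :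
    latticeFourier γ (-k) • ∑ y, wave k y • r y + latticeFourier α (-k) • ∑ y, wave k y • c y = 0 := by
  rw [← sum_wave_smul_conv, ← sum_wave_smul_conv, ← Finset.sum_add_distrib]
  refine Finset.sum_eq_zero fun x _ => ?_
  rw [← smul_add, conv_eq_zero hγ hα h, smul_zero]

end Fourier

/-! ### Translation invariant networks -/

section TorusNetwork

variable {n : ℕ} [NeZero n]

/-- The weights of a translation invariant network, in terms of the kinds of the units (`true`
for visible ones) and of their displacement. -/
def torusKernel (α β : Site n → ℂ) : Bool → Bool → Site n → ℂ
  | true, _, _ => 0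
  | false, true, d => α d
  | false, false, d => β d

variable (n) in
/-- An enumeration of the sites other than the origin. -/
def punctured : Fin (Fintype.card {x : Site n // x ≠ 0}) ≃ {x : Site n // x ≠ 0} :=
  (Fintype.equivFin _).symm

/-- The network with one hidden unit at each site other than the origin, and with
translation invariant weights. -/
def torusNetwork (α β : Site n → ℂ) : FermionicNetwork n where
  numHidden := Fintype.card {x : Site n // x ≠ 0}
  hiddenPos h := punctured n h
  weight j k := torusKernel α β j.isLeft k.isLeft
    (Sum.elim id (fun h => (punctured n h : Site n)) k - Sum.elim id (fun h => (punctured n h : Site n)) j)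

variable {α β : Site n → ℂ}

theorem torusNetwork_weight_visible (x : Site n) (j : (torusNetwork α β).Neuron) :
    (torusNetwork α β).weight (Sum.inl x) j = 0 := rfl

theorem torusNetwork_weight_hidden_visible (h : Fin (torusNetwork α β).numHidden) (x : Site n) :
    (torusNetwork α β).weight (Sum.inr h) (Sum.inl x)
      = α (x - (torusNetwork α β).hiddenPos h) := rfl

theorem torusNetwork_weight_hidden (h h' : Fin (torusNetwork α β).numHidden) :
    (torusNetwork α β).weight (Sum.inr h) (Sum.inr h')
      = β ((torusNetwork α β).hiddenPos h' - (torusNetwork α β).hiddenPos h) := rfl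

theorem torusNetwork_hiddenPos_ne (h : Fin (torusNetwork α β).numHidden) :
    (torusNetwork α β).hiddenPos h ≠ 0 := (punctured n h).2

theorem exists_torusNetwork_hiddenPos (α β : Site n → ℂ) {x : Site n} (hx : x ≠ 0) :
    ∃ h, (torusNetwork α β).hiddenPos h = x :=
  ⟨(punctured n).symm ⟨x, hx⟩, congrArg Subtype.val ((punctured n).apply_symm_apply ⟨x, hx⟩)⟩

/-- Extension of a function on the hidden units to all sites by zero. -/
def extendHidden {F : Type*} [Zero F] (r : Fin (torusNetwork α β).numHidden → F) (y : Site n) : F :=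
  if hy : y ≠ 0 then r ((punctured n).symm ⟨y, hy⟩) else 0

theorem extendHidden_zero {F : Type*} [Zero F] (r : Fin (torusNetwork α β).numHidden → F) :
    extendHidden r 0 = 0 := by
  simp [extendHidden]

theorem extendHidden_hiddenPos {F : Type*} [Zero F] (r : Fin (torusNetwork α β).numHidden → F) (h) :
    extendHidden r ((torusNetwork α β).hiddenPos h) = r h := by
  rw [extendHidden, dif_pos (torusNetwork_hiddenPos_ne h)]
  exact congrArg r ((punctured n).symm_apply_apply h)

theorem sum_hidden {F : Type*} [AddCommGroup F] [Module ℂ F]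
    (r : Fin (torusNetwork α β).numHidden → F) (f : Site n → ℂ) :
    ∑ h, f ((torusNetwork α β).hiddenPos h) • r h = ∑ y, f y • extendHidden r y := by
  rw [← Finset.sum_erase (a := (0 : Site n)) Finset.univ (by rw [extendHidden_zero, smul_zero]),
    Finset.sum_subtype _ (p := fun x : Site n => x ≠ 0) (by simp), ← Equiv.sum_comp (punctured n)]
  refine Finset.sum_congr rfl fun h _ => ?_
  rw [← extendHidden_hiddenPos r h]
  rfl

theorem latticeFourier_odd (β : Site n → ℂ) (k : Site n) :
    latticeFourier (fun d => β d - β (-d)) k = latticeFourier β k - latticeFourier β (-k) := by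
  rw [← latticeFourier_comp_neg, latticeFourier, latticeFourier, latticeFourier, ← Finset.sum_sub_distrib]
  simp only [mul_sub]

theorem sum_odd (β : Site n → ℂ) : ∑ d, (β d - β (-d)) = 0 := by
  rw [← latticeFourier_zero, latticeFourier_odd, neg_zero, sub_self]

/-- If the hidden couplings have no zero mode besides the constant, they are nondegenerate on the
punctured torus. -/
theorem hidden_couplings_injective {F : Type*} [AddCommGroup F] [Module ℂ F]
    (hβ : ∀ k : Site n, k ≠ 0 → latticeFourier β k - latticeFourier β (-k) ≠ 0)
    (r : Fin (torusNetwork α β).numHidden → F)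
    (hr : ∀ h, ∑ h', ((torusNetwork α β).weight (Sum.inr h) (Sum.inr h')
      - (torusNetwork α β).weight (Sum.inr h') (Sum.inr h)) • r h' = 0) : r = 0 := by
  have h1 : ∀ x : Site n, x ≠ 0 → ∑ y, (fun d => β d - β (-d)) (y - x) • extendHidden r y
      + ∑ y, (fun _ => (0 : ℂ)) (y - x) • (0 : Site n → F) y = 0 := by
    intro x hx
    obtain ⟨h, rfl⟩ := exists_torusNetwork_hiddenPos α β hx
    have h2 := hr h
    simp only [torusNetwork_weight_hidden] at h2
    rw [← sum_hidden r fun y => (fun d => β d - β (-d)) (y - (torusNetwork α β).hiddenPos h)]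
    simpa only [neg_sub, smul_zero, zero_smul, Finset.sum_const_zero, add_zero] using h2
  have h3 := latticeFourier_conv_eq_zero (sum_odd β) Finset.sum_const_zero h1
  have h4 : ∀ k : Site n, k ≠ 0 → ∑ y, wave k y • extendHidden r y = 0 := by
    intro k hk
    have h5 := h3 k
    rw [latticeFourier_odd] at h5
    simp only [Pi.zero_apply, smul_zero, Finset.sum_const_zero, add_zero] at h5
    exact (smul_eq_zero.1 h5).resolve_left (hβ (-k) (neg_ne_zero.2 hk))
  funext h
  rw [← extendHidden_hiddenPos r h, eq_of_fourier_eq_zero h4 _ 0, extendHidden_zero, Pi.zero_apply]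

theorem torusNetwork_ne_zero (hβ : ∀ k : Site n, k ≠ 0 → latticeFourier β k - latticeFourier β (-k) ≠ 0) :
    (torusNetwork α β).unnormalizedState ≠ 0 :=
  FermionicNetwork.unnormalizedState_ne_zero _ (hidden_couplings_injective hβ)

/-- The state of a translation invariant network is annihilated by quasiparticle operators whose
amplitudes are ratios of Fourier transforms of the weights. -/
theorem adjoint_momCreate_torusNetwork (hα : latticeFourier α 0 = 0)
    (hβ : ∀ k : Site n, k ≠ 0 → latticeFourier β k - latticeFourier β (-k) ≠ 0) (k : Site n) :
    LinearMap.adjoint (momCreate k) (torusNetwork α β).unnormalizedState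
      = (-(latticeFourier α k * latticeFourier α (-k)) / (latticeFourier β k - latticeFourier β (-k))) •
        momCreate (-k) (torusNetwork α β).unnormalizedState := by
  set s : ℂ := (-1) ^ (torusNetwork α β).numHidden with hs
  have hss : s * s = 1 := by rw [hs, ← mul_pow]; simp
  rw [FermionicNetwork.unnormalizedState_eq]
  set φ := (torusNetwork α β).readout (torusNetwork α β).boltzmann with hφ
  set r : Fin (torusNetwork α β).numHidden → Fock (Site n) := fun h =>
    (torusNetwork α β).readout ((torusNetwork α β).boltzmann * (torusNetwork α β).xi (Sum.inr h))
    with hr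
  have h1 : ∀ x : Site n, x ≠ 0 → ∑ y, (fun d => β d - β (-d)) (y - x) • extendHidden r y
      + ∑ y, α (y - x) • (s • create y φ) = 0 := by
    intro x hx
    obtain ⟨h, rfl⟩ := exists_torusNetwork_hiddenPos α β hx
    have h2 := (torusNetwork α β).sum_readout_hidden h 1
    simp only [FermionicNetwork.berezin_one, mul_one, mul_zero, map_zero, torusNetwork_weight_hidden,
      torusNetwork_weight_hidden_visible, torusNetwork_weight_visible, sub_zero, Finset.smul_sum,
      smul_comm ((-1 : ℂ) ^ (torusNetwork α β).numHidden)] at h2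
    rw [← sum_hidden r fun y => (fun d => β d - β (-d)) (y - (torusNetwork α β).hiddenPos h)]
    simp only [neg_sub]
    exact h2
  have h3 := latticeFourier_conv_eq_zero (sum_odd β) (by rwa [← latticeFourier_zero]) h1 (-k)
  rw [neg_neg, latticeFourier_odd] at h3
  have h4 : ∀ x : Site n, annihilate x φ = s • ∑ y, (fun d => α (-d)) (y - x) • extendHidden r y := by
    intro x
    have h5 := (torusNetwork α β).annihilate_readout (fun _ _ => rfl) x
    rw [← sum_hidden r fun y => (fun d => α (-d)) (y - x)]
    have h6 := congrArg (fun v => s • v) h5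
    simp only [smul_smul, ← hs, hss, one_smul, torusNetwork_weight_hidden_visible,
      torusNetwork_weight_visible, zero_sub, neg_smul, Finset.sum_neg_distrib, neg_neg] at h6
    simp only [neg_sub]
    exact h6
  have h5 : LinearMap.adjoint (momCreate k) φ
      = (n : ℂ)⁻¹ • (s * latticeFourier α (-k)) • ∑ y, wave (-k) y • extendHidden r y := by
    have h6 := sum_wave_smul_conv (fun d => α (-d)) (extendHidden r) (-k)
    rw [latticeFourier_comp_neg, neg_neg] at h6
    rw [mul_smul, ← h6, adjoint_momCreate]
    simp only [LinearMap.smul_apply, LinearMap.sum_apply, h4, Finset.smul_sum (r := s), smul_comm s]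
  have h6 : ∑ y, wave (-k) y • (s • create y φ) = (s * n) • momCreate (-k) φ := by
    rw [momCreate, LinearMap.smul_apply, smul_smul, mul_assoc, mul_inv_cancel₀ natCast_ne_zero, mul_one]
    simp only [LinearMap.smul_apply, LinearMap.sum_apply, Finset.smul_sum, smul_comm s]
  rw [h6] at h3
  rw [h5]
  by_cases hk : k = 0
  · simp [hk, hα]
  · have hB := hβ k hk
    set B := latticeFourier β k - latticeFourier β (-k)
    set R := ∑ y, wave (-k) y • extendHidden r y
    have h7 : R = (-(B⁻¹ * latticeFourier α k * (s * n))) • momCreate (-k) φ := by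
      have h8 := congrArg (fun v => B⁻¹ • v) (eq_neg_of_add_eq_zero_left h3)
      simp only [smul_smul, inv_mul_cancel₀ hB, one_smul] at h8
      rw [h8]
      module
    rw [h7, smul_smul, smul_smul]
    congr 1
    have hn := natCast_ne_zero (n := n)
    field_simp
    linear_combination (-(latticeFourier α k * latticeFourier α (-k))) * hss

end TorusNetwork

/-! ### Local multipliers -/

section Locality

variable {n : ℕ}

theorem torusDist_eq_sub (x y : Site n) : torusDist x y = torusDist (y - x) 0 := by
  simp only [torusDist, Prod.fst_zero, Prod.snd_zero, sub_zero, Prod.fst_sub, Prod.snd_sub]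
  rw [← ZMod.natAbs_valMinAbs_neg (y.1 - x.1), ← ZMod.natAbs_valMinAbs_neg (y.2 - x.2), neg_sub,
    neg_sub]

theorem torusDist_neg_zero (x : Site n) : torusDist (-x) 0 = torusDist x 0 := by
  simp [torusDist, ZMod.natAbs_valMinAbs_neg]

theorem torusDist_add_zero_le (x y : Site n) :
    torusDist (x + y) 0 ≤ torusDist x 0 + torusDist y 0 := by
  simp only [torusDist, Prod.fst_zero, Prod.snd_zero, sub_zero, Prod.fst_add, Prod.snd_add]
  have h1 := (ZMod.natAbs_valMinAbs_add_le x.1 y.1).trans (Int.natAbs_add_le _ _)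
  have h2 := (ZMod.natAbs_valMinAbs_add_le x.2 y.2).trans (Int.natAbs_add_le _ _)
  omega

variable [NeZero n]

theorem natAbs_valMinAbs_one_le : (1 : ZMod n).valMinAbs.natAbs ≤ 1 := by
  rw [ZMod.valMinAbs_natAbs_eq_min, ZMod.val_one_eq_one_mod]
  exact (min_le_left _ _).trans (Nat.mod_le _ _)

/-- A function of the momentum is local with range `R` if it is the Fourier transform of a function
supported within distance `R` of the origin. -/
def IsLocal (R : ℕ) (S : Site n → ℂ) : Prop :=
  ∃ f : Site n → ℂ, latticeFourier f = S ∧ ∀ d, f d ≠ 0 → torusDist d 0 ≤ R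

namespace IsLocal

variable {R R' : ℕ} {S S' : Site n → ℂ}

theorem mono (h : IsLocal R S) (hR : R ≤ R') : IsLocal R' S := by
  obtain ⟨f, hf, hs⟩ := h
  exact ⟨f, hf, fun d hd => (hs d hd).trans hR⟩

theorem wave (v : Site n) : IsLocal (torusDist v 0) fun k => PWave.wave k v := by
  refine ⟨Pi.single v 1, ?_, fun d hd => ?_⟩
  · funext k
    simp [latticeFourier, Pi.single_apply]
  · by_cases h : d = v
    · rw [h]
    · simp [h] at hd

theorem const_smul (h : IsLocal R S) (c : ℂ) : IsLocal R fun k => c * S k := by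
  obtain ⟨f, rfl, hs⟩ := h
  refine ⟨fun d => c * f d, ?_, fun d hd => hs d (right_ne_zero_of_mul hd)⟩
  funext k
  simp only [latticeFourier, Finset.mul_sum]
  exact Finset.sum_congr rfl fun d _ => by ring

theorem add (h : IsLocal R S) (h' : IsLocal R S') : IsLocal R fun k => S k + S' k := by
  obtain ⟨f, rfl, hs⟩ := h
  obtain ⟨f', rfl, hs'⟩ := h'
  refine ⟨fun d => f d + f' d, ?_, fun d hd => ?_⟩
  · funext k
    simp only [latticeFourier, mul_add, Finset.sum_add_distrib]
  · by_cases h : f d = 0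
    · exact hs' d fun h' => hd (by simp [h, h'])
    · exact hs d h

theorem sub (h : IsLocal R S) (h' : IsLocal R S') : IsLocal R fun k => S k - S' k := by
  simpa [sub_eq_add_neg] using h.add (h'.const_smul (-1))

theorem const (c : ℂ) : IsLocal R fun _ : Site n => c := by
  have h := (IsLocal.wave (0 : Site n)).const_smul c
  simp only [wave_zero_right, mul_one] at h
  exact h.mono (by simp [torusDist])

theorem mul (h : IsLocal R S) (h' : IsLocal R' S') : IsLocal (R + R') fun k => S k * S' k := by
  obtain ⟨f, rfl, hs⟩ := h
  obtain ⟨f', rfl, hs'⟩ := h'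
  refine ⟨fun d => ∑ y, f y * f' (d - y), ?_, fun d hd => ?_⟩
  · funext k
    rw [latticeFourier, latticeFourier, latticeFourier, Finset.sum_mul_sum]
    simp only [Finset.mul_sum]
    rw [Finset.sum_comm]
    refine Finset.sum_congr rfl fun y _ => ?_
    rw [← Equiv.sum_comp (Equiv.addLeft y)]
    refine Finset.sum_congr rfl fun d _ => ?_
    rw [Equiv.coe_addLeft, add_sub_cancel_left, wave_add_right]
    ring
  · obtain ⟨y, -, hy⟩ := Finset.exists_ne_zero_of_sum_ne_zero hd
    have h1 := hs y (left_ne_zero_of_mul hy)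
    have h2 := hs' (d - y) (right_ne_zero_of_mul hy)
    have h3 := torusDist_add_zero_le y (d - y)
    rw [add_sub_cancel] at h3
    omega

theorem pow (h : IsLocal R S) (j : ℕ) : IsLocal (R * j) fun k => S k ^ j := by
  induction j with
  | zero => simpa using IsLocal.const (n := n) (R := R * 0) 1
  | succ j ih =>
    simp only [pow_succ]
    exact ih.mul h

theorem sum {d : ℕ} {T : ℕ → Site n → ℂ} (h : ∀ j < d, IsLocal R (T j)) :
    IsLocal R fun k => ∑ j ∈ Finset.range d, T j k := by
  induction d with
  | zero => simpa using IsLocal.const (n := n) (R := R) 0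
  | succ d ih =>
    simp only [Finset.sum_range_succ]
    exact (ih fun j hj => h j (by omega)).add (h d (by omega))

theorem stdAddChar_fst : IsLocal 1 fun k : Site n => ZMod.stdAddChar k.1 := by
  have h := (IsLocal.wave ((1, 0) : Site n)).mono (R' := 1)
    (by simpa [torusDist] using natAbs_valMinAbs_one_le)
  simpa only [wave_fst] using h

theorem stdAddChar_snd : IsLocal 1 fun k : Site n => ZMod.stdAddChar k.2 := by
  have h := (IsLocal.wave ((0, 1) : Site n)).mono (R' := 1)
    (by simpa [torusDist] using natAbs_valMinAbs_one_le)
  simpa only [wave_snd] using h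

theorem conj_stdAddChar_fst :
    IsLocal 1 fun k : Site n => (starRingEnd ℂ) (ZMod.stdAddChar k.1) := by
  have h := (IsLocal.wave (-(1, 0) : Site n)).mono (R' := 1)
    (by rw [torusDist_neg_zero]; simpa [torusDist] using natAbs_valMinAbs_one_le)
  simp only [wave_neg_right, wave_neg_left] at h
  simpa only [wave_fst] using h

theorem conj_stdAddChar_snd :
    IsLocal 1 fun k : Site n => (starRingEnd ℂ) (ZMod.stdAddChar k.2) := by
  have h := (IsLocal.wave (-(0, 1) : Site n)).mono (R' := 1)
    (by rw [torusDist_neg_zero]; simpa [torusDist] using natAbs_valMinAbs_one_le)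
  simp only [wave_neg_right, wave_neg_left] at h
  simpa only [wave_snd] using h

theorem kinetic (μ : ℝ) : IsLocal 1 fun k : Site n => (PWave.kinetic μ k : ℂ) := by
  have h := ((stdAddChar_fst (n := n)).add conj_stdAddChar_fst).add
    (stdAddChar_snd.add conj_stdAddChar_snd) |>.sub (IsLocal.const (2 * μ))
  convert h using 2 with k
  apply Complex.ext <;> simp [PWave.kinetic] <;> ring

theorem pairing : IsLocal 1 fun k : Site n => PWave.pairing k := by
  have h := ((stdAddChar_snd (n := n)).sub conj_stdAddChar_snd).const_smul (-Complex.I) |>.sub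
    (stdAddChar_fst.sub conj_stdAddChar_fst)
  convert h using 2 with k
  apply Complex.ext <;> simp [PWave.pairing] <;> ring

theorem conj_pairing : IsLocal 1 fun k : Site n => (starRingEnd ℂ) (PWave.pairing k) := by
  have h := ((stdAddChar_snd (n := n)).sub conj_stdAddChar_snd).const_smul (-Complex.I) |>.add
    (stdAddChar_fst.sub conj_stdAddChar_fst)
  convert h using 2 with k
  apply Complex.ext <;> simp [PWave.pairing] <;> ring

theorem dispersion_sq (μ : ℝ) :
    IsLocal 2 fun k : Site n => (PWave.dispersion μ k ^ 2 : ℂ) := by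
  have h := ((IsLocal.kinetic (n := n) μ).mul (IsLocal.kinetic μ)).add
    (IsLocal.pairing.mul IsLocal.conj_pairing)
  convert h using 2 with k
  rw [Complex.mul_conj, Complex.normSq_eq_norm_sq]
  have := congrArg (fun x : ℝ => (x : ℂ)) (PWave.dispersion_sq μ k)
  push_cast at this ⊢
  rw [this, sq (PWave.kinetic μ k : ℂ)]

end IsLocal

end Locality

/-! ### Polynomial approximation -/

section Approximation

/-- The square root is approximated by polynomials away from zero, exponentially well in the
degree. -/
theorem exists_sqrt_approx {a : ℝ} (ha : 0 < a) (ha1 : a ≤ 1) :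
    ∃ (q : ℕ → ℂ) (ρ C : ℝ), 0 < ρ ∧ ρ < 1 ∧ 0 < C ∧ ∀ t : ℝ, 0 ≤ t → t ≤ 1 - a → ∀ d : ℕ,
      ‖∑ j ∈ Finset.range d, q j * (t : ℂ) ^ j - (√(1 - t) : ℝ)‖ ≤ C * ρ ^ d := by
  have hR : 0 < 1 - a / 3 := by linarith
  have hr : 0 < 1 - a / 2 := by linarith
  set R : NNReal := ⟨1 - a / 3, hR.le⟩
  set r : NNReal := ⟨1 - a / 2, hr.le⟩
  have hdiff : DifferentiableOn ℂ (fun z : ℂ => (1 - z) ^ (1 / 2 : ℂ)) (Metric.closedBall 0 R) := by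
    intro z hz
    have hz' : ‖z‖ ≤ 1 - a / 3 := mem_closedBall_zero_iff.1 hz
    refine DifferentiableAt.differentiableWithinAt ?_
    refine DifferentiableAt.cpow (by fun_prop) (by fun_prop) (Or.inl ?_)
    have := Complex.re_le_norm z
    simp only [Complex.sub_re, Complex.one_re]
    linarith
  have hp := hdiff.hasFPowerSeriesOnBall (NNReal.coe_pos.1 hR)
  have hrR : (r : ENNReal) < R := by
    rw [ENNReal.coe_lt_coe, ← NNReal.coe_lt_coe]
    change 1 - a / 2 < 1 - a / 3
    linarith
  obtain ⟨ρ, ⟨hρ0, hρ1⟩, C, hC, happ⟩ := hp.uniform_geometric_approx hrR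
  refine ⟨fun j => (cauchyPowerSeries (fun z : ℂ => (1 - z) ^ (1 / 2 : ℂ)) 0 R).coeff j, ρ, C, hρ0,
    hρ1, hC, fun t ht0 ht1 d => ?_⟩
  have h1 := happ (t : ℂ) (by
    rw [mem_ball_zero_iff, Complex.norm_real, Real.norm_of_nonneg ht0]
    change t < 1 - a / 2
    linarith) d
  have h2 : ((1 - (t : ℂ)) ^ (1 / 2 : ℂ)) = (√(1 - t) : ℝ) := by
    rw [Real.sqrt_eq_rpow, Complex.ofReal_cpow (by linarith)]
    push_cast; rfl
  rw [zero_add, h2, norm_sub_rev, FormalMultilinearSeries.partialSum] at h1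
  simpa only [FormalMultilinearSeries.apply_eq_pow_smul_coeff, smul_eq_mul, mul_comm] using h1

/-- A logarithmic degree makes an exponentially small error polynomially small. -/
theorem exists_log_degree {ρ C : ℝ} (hρ0 : 0 < ρ) (hρ1 : ρ < 1) (hC : 0 < C) :
    ∃ K : ℝ, ∀ n : ℕ, 3 ≤ n → ∃ d : ℕ, (d : ℝ) ≤ K * Real.log n ∧ C * n ^ 5 * ρ ^ d ≤ 1 := by
  have hl : 0 < -Real.log ρ := neg_pos.2 (Real.log_neg hρ0 hρ1)
  set M := max 0 (Real.log C)
  refine ⟨(5 + M) / (-Real.log ρ) + 1, fun n hn => ?_⟩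
  have hn0 : (0 : ℝ) < n := by positivity
  have hlog : 1 ≤ Real.log n := by
    rw [Real.le_log_iff_exp_le hn0]
    have h3 : (3 : ℝ) ≤ n := by exact_mod_cast hn
    linarith [Real.exp_one_lt_d9]
  have hM : 0 ≤ M := le_max_left _ _
  refine ⟨⌈(5 + M) / (-Real.log ρ) * Real.log n⌉₊, ?_, ?_⟩
  · have := (Nat.ceil_lt_add_one (a := (5 + M) / (-Real.log ρ) * Real.log n) (by positivity)).le
    linarith
  · set d := ⌈(5 + M) / (-Real.log ρ) * Real.log n⌉₊
    have hd : (5 + M) / (-Real.log ρ) * Real.log n ≤ d := Nat.le_ceil _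
    rw [div_mul_eq_mul_div, div_le_iff₀ hl] at hd
    rw [← Real.log_nonpos_iff (by positivity), Real.log_mul (by positivity) (by positivity),
      Real.log_mul (by positivity) (by positivity), Real.log_pow, Real.log_pow]
    have h1 : Real.log C ≤ M := le_max_right _ _
    push_cast
    nlinarith

variable {n : ℕ} [NeZero n]

theorem abs_re_stdAddChar_le (j : ZMod n) : |(ZMod.stdAddChar j).re| ≤ 1 :=
  (Complex.abs_re_le_norm _).trans (AddChar.norm_apply _ _).le

theorem dispersion_sq_ge (μ : ℝ) (hμ0 : 0 < μ) (k : Site n) :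
    4 * min (μ ^ 2) ((2 - μ) ^ 2) ≤ dispersion μ k ^ 2 := by
  have h1 := re_sq_add_im_sq_stdAddChar k.1
  have h2 := re_sq_add_im_sq_stdAddChar k.2
  have h3 := abs_le.1 (abs_re_stdAddChar_le k.1)
  have h4 := abs_le.1 (abs_re_stdAddChar_le k.2)
  rw [dispersion_sq, norm_pairing_sq, kinetic]
  generalize (ZMod.stdAddChar k.1).re = x at *
  generalize (ZMod.stdAddChar k.2).re = y at *
  set m := min (μ ^ 2) ((2 - μ) ^ 2)
  have m1 : m ≤ μ ^ 2 := min_le_left _ _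
  have m2 : m ≤ (2 - μ) ^ 2 := min_le_right _ _
  have m3 : m ≤ (2 + μ) ^ 2 := by nlinarith
  have e1 := mul_nonneg (mul_nonneg (sub_nonneg.2 h3.2) (sub_nonneg.2 h4.2)) (sub_nonneg.2 m3)
  have e2 := mul_nonneg (mul_nonneg (sub_nonneg.2 h3.2) (neg_le_iff_add_nonneg'.1 h4.1))
    (sub_nonneg.2 m1)
  have e3 := mul_nonneg (mul_nonneg (neg_le_iff_add_nonneg'.1 h3.1) (sub_nonneg.2 h4.2))
    (sub_nonneg.2 m1)
  have e4 := mul_nonneg (mul_nonneg (neg_le_iff_add_nonneg'.1 h3.1) (neg_le_iff_add_nonneg'.1 h4.1))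
    (sub_nonneg.2 m2)
  linarith

theorem abs_kinetic_le {μ : ℝ} (hμ0 : 0 < μ) (hμ2 : μ < 2) (k : Site n) : |kinetic μ k| ≤ 8 := by
  have h3 := abs_le.1 (abs_re_stdAddChar_le k.1)
  have h4 := abs_le.1 (abs_re_stdAddChar_le k.2)
  rw [kinetic, abs_le]
  constructor <;> linarith

theorem dispersion_le {μ : ℝ} (hμ0 : 0 < μ) (hμ2 : μ < 2) (k : Site n) : dispersion μ k ≤ 10 := by
  have h1 := re_sq_add_im_sq_stdAddChar k.1
  have h2 := re_sq_add_im_sq_stdAddChar k.2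
  have h3 := sq_le_sq.2 ((abs_kinetic_le hμ0 hμ2 k).trans (le_abs_self 8))
  refine Real.sqrt_le_iff.2 ⟨by norm_num, ?_⟩
  rw [norm_pairing_sq]
  nlinarith [sq_nonneg (ZMod.stdAddChar k.1).re, sq_nonneg (ZMod.stdAddChar k.2).re]

theorem one_le_dispersion_sub_kinetic (hn : Odd n) {μ : ℝ} (hμ0 : 0 < μ) (hμ2 : μ < 2)
    {k : Site n} (hk : k ≠ 0) : 1 ≤ 20 * (n : ℝ) ^ 2 * (dispersion μ k - kinetic μ k) := by
  have h1 := one_le_norm_pairing hn hk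
  have h2 := dispersion_sub_mul_add μ k
  have h3 := abs_le.1 (abs_kinetic_le hμ0 hμ2 k)
  have h4 := dispersion_le hμ0 hμ2 k
  have h5 : 0 ≤ dispersion μ k - kinetic μ k :=
    sub_nonneg.2 ((le_abs_self _).trans (kinetic_le_dispersion μ k))
  calc (1 : ℝ) ≤ n ^ 2 * ((dispersion μ k - kinetic μ k) * (dispersion μ k + kinetic μ k)) := by
        rwa [h2]
    _ ≤ n ^ 2 * ((dispersion μ k - kinetic μ k) * 20) := by
        gcongr
        linarith
    _ = _ := by ring

/-- The function `E - ε` of the momentum has local approximations of logarithmic range that are even,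
vanish at zero momentum and are accurate to a relative error `O(n⁻³)`. -/
theorem exists_local_approx {μ : ℝ} (hμ0 : 0 < μ) (hμ2 : μ < 2) :
    ∃ C : ℝ, ∀ (n : ℕ) [NeZero n], Odd n → ∃ (S : Site n → ℂ) (R : ℕ), IsLocal R S ∧
      (n ≠ 1 → (R + 1 : ℝ) ≤ C * Real.log n) ∧ (∀ k, S (-k) = S k) ∧ S 0 = 0 ∧
      ∀ k, k ≠ 0 → ‖S k - (dispersion μ k - kinetic μ k : ℝ)‖
        ≤ (dispersion μ k - kinetic μ k) / (2 * n ^ 3) := by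
  set a : ℝ := min (μ ^ 2) ((2 - μ) ^ 2) / 25 with ha
  have hμ2' : 0 < 2 - μ := sub_pos.2 hμ2
  have ha0 : 0 < a := by positivity
  have ha1 : a ≤ 1 := by
    have : min (μ ^ 2) ((2 - μ) ^ 2) ≤ μ ^ 2 := min_le_left _ _
    have : μ ^ 2 ≤ 4 := by nlinarith
    rw [ha]; linarith
  obtain ⟨q, ρ, C, hρ0, hρ1, hC, happ⟩ := exists_sqrt_approx ha0 ha1
  obtain ⟨K, hK⟩ := exists_log_degree hρ0 hρ1 (show 0 < 800 * C by positivity)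
  refine ⟨2 * K + 2, fun n _ hn => ?_⟩
  obtain ⟨d, hd1, hd2⟩ : ∃ d : ℕ, (n ≠ 1 → ((2 * d + 1 : ℕ) + 1 : ℝ) ≤ (2 * K + 2) * Real.log n) ∧
      (n ≠ 1 → 800 * C * n ^ 5 * ρ ^ d ≤ 1) := by
    by_cases h1 : n = 1
    · exact ⟨0, fun h => absurd h1 h, fun h => absurd h1 h⟩
    · have h3 : 3 ≤ n := by
        rcases hn with ⟨m, rfl⟩
        omega
      obtain ⟨d, h4, h5⟩ := hK n h3
      have hlog : 1 ≤ Real.log n := by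
        rw [Real.le_log_iff_exp_le (by positivity)]
        have h3 : (3 : ℝ) ≤ n := by exact_mod_cast h3
        linarith [Real.exp_one_lt_d9]
      refine ⟨d, fun _ => ?_, fun _ => h5⟩
      push_cast
      linarith
  set t : Site n → ℝ := fun k => 1 - dispersion μ k ^ 2 / 100 with ht
  set p : Site n → ℂ := fun k => ∑ j ∈ Finset.range d, q j * (t k : ℂ) ^ j with hp
  have ht0 : ∀ k, 0 ≤ t k := fun k => by
    have h1 := dispersion_le hμ0 hμ2 k
    have h2 : 0 ≤ dispersion μ k := Real.sqrt_nonneg _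
    simp only [ht]
    nlinarith
  have ht1 : ∀ k, t k ≤ 1 - a := fun k => by
    have := dispersion_sq_ge μ hμ0 k
    simp only [ht, ha]
    linarith
  have hsqrt : ∀ k, √(1 - t k) = dispersion μ k / 10 := fun k => by
    have h1 : 1 - t k = (dispersion μ k / 10) ^ 2 := by simp only [ht]; ring
    have h2 : 0 ≤ dispersion μ k := Real.sqrt_nonneg _
    rw [h1, Real.sqrt_sq (by positivity)]
  have hpk : ∀ k, ‖10 * p k - dispersion μ k‖ ≤ 10 * (C * ρ ^ d) := fun k => by
    have h1 := happ (t k) (ht0 k) (ht1 k) d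
    rw [hsqrt] at h1
    have h2 : 10 * p k - dispersion μ k
        = 10 * (∑ j ∈ Finset.range d, q j * (t k : ℂ) ^ j - (dispersion μ k / 10 : ℝ)) := by
      simp only [hp]; push_cast; ring
    rw [h2, norm_mul]
    simpa using h1
  have hE0 := dispersion_zero (n := n) hμ2
  refine ⟨fun k => 10 * p k - kinetic μ k - (10 * p 0 - dispersion μ (0 : Site n)), 2 * d + 1, ?_, hd1,
    fun k => ?_, ?_, fun k hk => ?_⟩
  · have hlt : IsLocal 2 fun k : Site n => (t k : ℂ) := by
      have := (IsLocal.const (n := n) (R := 2) 1).sub ((IsLocal.dispersion_sq μ).const_smul (1 / 100))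
      convert this using 2 with k
      simp only [ht]; push_cast; ring
    have hlp : IsLocal (2 * d) p :=
      IsLocal.sum fun j hj => ((hlt.pow j).mono (by omega)).const_smul (q j)
    exact (((hlp.const_smul 10).mono (by omega)).sub ((IsLocal.kinetic μ).mono (by omega))).sub
      (IsLocal.const _)
  · simp only [hp, ht, dispersion_neg, kinetic_neg]
  · simp only [hE0]; ring
  · have hn1 : n ≠ 1 := by
      rintro rfl
      exact hk (Subsingleton.elim _ _)
    have hn0 : (0 : ℝ) < n := Nat.cast_pos.2 (Nat.pos_of_ne_zero (NeZero.ne n))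
    have h1 := one_le_dispersion_sub_kinetic hn hμ0 hμ2 hk
    have h2 : ‖10 * p k - kinetic μ k - (10 * p 0 - dispersion μ (0 : Site n))
        - (dispersion μ k - kinetic μ k : ℝ)‖ ≤ 20 * (C * ρ ^ d) := by
      have : 10 * p k - kinetic μ k - (10 * p 0 - dispersion μ (0 : Site n))
        - (dispersion μ k - kinetic μ k : ℝ)
        = (10 * p k - dispersion μ k) - (10 * p 0 - dispersion μ (0 : Site n)) := by
        push_cast; ring
      rw [this]
      refine (norm_sub_le _ _).trans ?_
      linarith [hpk k, hpk 0]
    refine h2.trans ?_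
    rw [le_div_iff₀ (by positivity)]
    have h3 := hd2 hn1
    have h4 : 0 ≤ C * ρ ^ d := by positivity
    have h5 : 20 * (n : ℝ) ^ 2 * (20 * (C * ρ ^ d) * (2 * n ^ 3)) ≤
        20 * (n : ℝ) ^ 2 * (dispersion μ k - kinetic μ k) := by
      refine le_trans ?_ h1
      linarith
    exact le_of_mul_le_mul_left h5 (by positivity)

end Approximation

section Main

variable {n : ℕ} [NeZero n]

theorem torusNetwork_numHidden (α β : Site n → ℂ) : (torusNetwork α β).numHidden + 1 = n ^ 2 := by
  change Fintype.card {x : Site n // x ≠ 0} + 1 = n ^ 2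
  rw [Fintype.card_subtype, Finset.filter_ne', Finset.card_erase_add_one (Finset.mem_univ _),
    Finset.card_univ, Fintype.card_prod, ZMod.card, sq]

theorem torusNetwork_hiddenPos_injective (α β : Site n → ℂ) :
    Function.Injective (torusNetwork α β).hiddenPos :=
  Subtype.val_injective.comp (punctured n).injective

theorem torusNetwork_translation_invariant (α β : Site n → ℂ) (j k : (torusNetwork α β).Neuron) :
    (torusNetwork α β).weight j k = torusKernel α β j.isLeft k.isLeft
      ((torusNetwork α β).pos k - (torusNetwork α β).pos j) := rfl

theorem torusNetwork_connection {α β : Site n → ℂ} {R : ℕ}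
    (hα : ∀ d, α d ≠ 0 → torusDist d 0 ≤ R) (hβ : ∀ d, β d ≠ 0 → torusDist d 0 ≤ R)
    {j k : (torusNetwork α β).Neuron} (h : (torusNetwork α β).weight j k ≠ 0) :
    torusDist ((torusNetwork α β).pos j) ((torusNetwork α β).pos k) ≤ R := by
  rw [torusNetwork_translation_invariant] at h
  rw [torusDist_eq_sub]
  generalize (torusNetwork α β).pos k - (torusNetwork α β).pos j = d at h
  rcases j with j | j <;> rcases k with k | k
  · exact absurd rfl h
  · exact absurd rfl h
  · exact hα d h
  · exact hβ d h

theorem norm_momCreate_apply_le (k : Site n) (φ : Fock (Site n)) : ‖momCreate k φ‖ ≤ ‖φ‖ := by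
  have h := isModes_momCreate.norm_adjoint_quasi_apply_sq (g := fun _ : Site n => 0) k φ
  rw [adjoint_quasi] at h
  simp only [map_zero, zero_smul, sub_zero, norm_zero, zero_pow two_ne_zero, add_zero, one_mul] at h
  refine abs_le_of_sq_le_sq' ?_ (norm_nonneg _) |>.2
  nlinarith [sq_nonneg ‖quasi momCreate (fun _ : Site n => (0 : ℂ)) k φ‖]

/-- A relative error of the numerator of the pair amplitude bounds the quasiparticle content. -/
theorem norm_quasi_le (hn : Odd n) {μ : ℝ} (hμ2 : μ < 2) {S : Site n → ℂ} {δ : ℝ}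
    (hS : ∀ k, k ≠ 0 → ‖S k - (dispersion μ k - kinetic μ k : ℝ)‖ ≤ δ * (dispersion μ k - kinetic μ k))
    {φ : Fock (Site n)} (hφ : ‖φ‖ = 1) (k : Site n)
    (h : LinearMap.adjoint (momCreate k) φ
      = (-(S k / (starRingEnd ℂ) (pairing k))) • momCreate (-k) φ) :
    ‖quasi momCreate (pairAmplitude μ) k φ‖ ≤ δ * ‖pairAmplitude μ k‖ := by
  have hpos := dispersion_add_kinetic_pos hn hμ2 k
  have hne : ((dispersion μ k + kinetic μ k : ℝ) : ℂ) ≠ 0 := by exact_mod_cast hpos.ne'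
  by_cases hk : k = 0
  · subst hk
    rw [quasi, LinearMap.sub_apply, h, LinearMap.smul_apply]
    simp [pairAmplitude, pairing_zero]
  · have hp : pairing k ≠ 0 := by
      intro h0
      have := one_le_norm_pairing hn hk
      rw [h0, norm_zero] at this
      norm_num at this
    have hp' : (starRingEnd ℂ) (pairing k) ≠ 0 := (map_ne_zero _).2 hp
    have hg : pairAmplitude μ k
        = -((dispersion μ k - kinetic μ k : ℝ) / (starRingEnd ℂ) (pairing k)) := by
      have h1 : pairing k * (starRingEnd ℂ) (pairing k)
          = ((dispersion μ k - kinetic μ k : ℝ) : ℂ) * (dispersion μ k + kinetic μ k : ℝ) := by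
        rw [Complex.mul_conj, Complex.normSq_eq_norm_sq, ← dispersion_sub_mul_add μ k]
        push_cast; ring
      rw [pairAmplitude, ← neg_div, div_eq_div_iff hne hp', neg_mul, neg_mul, h1]
    have hq : quasi momCreate (pairAmplitude μ) k φ
        = (-((S k - (dispersion μ k - kinetic μ k : ℝ)) / (starRingEnd ℂ) (pairing k))) •
          momCreate (-k) φ := by
      rw [quasi, LinearMap.sub_apply, h, LinearMap.smul_apply, ← sub_smul, hg]
      congr 1
      ring
    rw [hq, hg, norm_smul, norm_neg, norm_neg, norm_div, norm_div]
    have hnonneg : 0 ≤ dispersion μ k - kinetic μ k :=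
      sub_nonneg.2 ((le_abs_self _).trans (kinetic_le_dispersion μ k))
    rw [Complex.norm_real, Real.norm_of_nonneg hnonneg, ← mul_div_assoc]
    refine (mul_le_of_le_one_right (by positivity)
      ((norm_momCreate_apply_le _ _).trans hφ.le)).trans ?_
    gcongr
    exact hS k hk

end Main

end PWave

end

open PWave in
theorem mainTheorem2 (μ : ℝ) (hμ0 : 0 < μ) (hμ2 : μ < 2) :
    ∃ C : ℝ, ∀ (n : ℕ) [NeZero n], Odd n →
      ∃ ψ : Fock (Site n),
        IsGroundState (hamiltonian n μ) ψ ∧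
        (∀ ψ' : Fock (Site n), IsGroundState (hamiltonian n μ) ψ' → ∃ c : ℂ, ψ' = c • ψ) ∧
        ∃ N : FermionicNetwork n,
          -- every site but one carries exactly one hidden unit
          Function.Injective N.hiddenPos ∧ N.numHidden + 1 = n ^ 2 ∧
          -- there are no connections between visible units
          (∀ x y : Site n, N.weight (Sum.inl x) (Sum.inl y) = 0) ∧
          -- the weights are translation invariant
          (∃ w : Bool → Bool → Site n → ℂ,
            ∀ j k : N.Neuron, N.weight j k = w j.isLeft k.isLeft (N.pos k - N.pos j)) ∧
          -- connections have length `O(log n)`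
          (∀ j k : N.Neuron, N.weight j k ≠ 0 → (torusDist (N.pos j) (N.pos k) : ℝ) ≤ C * Real.log n) ∧
          -- the fidelity is `1 - O(1/n)`
          ‖N.state‖ = 1 ∧ 1 - C / n ≤ ‖⟪N.state, ψ⟫_ℂ‖ := by
  obtain ⟨C, hC⟩ := exists_local_approx hμ0 hμ2
  refine ⟨max C 1, fun n _ hn => ?_⟩
  obtain ⟨ψ, hψ, hψu, hψk⟩ := exists_unique_ground_state hn hμ2
  obtain ⟨S, R, hSloc, hR, hSeven, hS0, hSapp⟩ := hC n hn
  have hn0 : (0 : ℝ) < n := Nat.cast_pos.2 (Nat.pos_of_ne_zero (NeZero.ne n))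
  obtain ⟨α, hα, hαs⟩ := hSloc.mono (Nat.le_succ R)
  obtain ⟨β, hβ, hβs⟩ := (hSloc.mul IsLocal.conj_pairing).const_smul (1 / 2)
  have hB : ∀ k, latticeFourier β k - latticeFourier β (-k) = S k * (starRingEnd ℂ) (pairing k) := by
    intro k
    simp only [hβ, hSeven, pairing_neg, map_neg]
    ring
  have hSne : ∀ k, k ≠ 0 → S k ≠ 0 := by
    intro k hk h0
    have h1 := hSapp k hk
    have h2 := one_le_dispersion_sub_kinetic hn hμ0 hμ2 hk
    have h3 : 0 < dispersion μ k - kinetic μ k := by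
      by_contra h
      have : 20 * (n : ℝ) ^ 2 * (dispersion μ k - kinetic μ k) ≤ 0 :=
        mul_nonpos_of_nonneg_of_nonpos (by positivity) (not_lt.1 h)
      linarith
    rw [h0, zero_sub, norm_neg, Complex.norm_real, Real.norm_of_nonneg h3.le] at h1
    have h4 : (1 : ℝ) ≤ (n : ℝ) ^ 3 := one_le_pow₀ (by exact_mod_cast NeZero.one_le)
    rw [le_div_iff₀ (by positivity)] at h1
    nlinarith
  have hpne : ∀ k : Site n, k ≠ 0 → (starRingEnd ℂ) (pairing k) ≠ 0 := by
    intro k hk h0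
    have := one_le_norm_pairing hn hk
    rw [(map_eq_zero _).1 h0, norm_zero] at this
    norm_num at this
  have hBne : ∀ k, k ≠ 0 → latticeFourier β k - latticeFourier β (-k) ≠ 0 := fun k hk => by
    rw [hB]; exact mul_ne_zero (hSne k hk) (hpne k hk)
  set N := torusNetwork α β with hN
  have hne : N.unnormalizedState ≠ 0 := torusNetwork_ne_zero hBne
  have hnorm : ‖N.state‖ = 1 := by
    rw [FermionicNetwork.state, norm_smul, norm_inv, Complex.norm_real, norm_norm,
      inv_mul_cancel₀ (norm_ne_zero_iff.2 hne)]
  have hann : ∀ k, LinearMap.adjoint (momCreate k) N.state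
      = (-(S k / (starRingEnd ℂ) (pairing k))) • momCreate (-k) N.state := by
    intro k
    rw [FermionicNetwork.state, map_smul, map_smul, hN,
      adjoint_momCreate_torusNetwork (by rw [hα, hS0]) hBne, hB, hα, hSeven, smul_comm]
    congr 3
    by_cases hk : k = 0
    · simp [hk, hS0]
    · have h1 := hSne k hk
      have h2 := hpne k hk
      field_simp
  refine ⟨ψ, hψ, hψu, N, torusNetwork_hiddenPos_injective α β, torusNetwork_numHidden α β,
    fun _ _ => rfl, ⟨torusKernel α β, torusNetwork_translation_invariant α β⟩, fun j k hjk => ?_,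
    hnorm, ?_⟩
  · by_cases h1 : n = 1
    · subst h1
      rw [Subsingleton.elim (N.pos j) (N.pos k)]
      simp [torusDist]
    · have h2 := torusNetwork_connection hαs hβs hjk
      calc (torusDist (N.pos j) (N.pos k) : ℝ) ≤ ((R + 1 : ℕ) : ℝ) := by exact_mod_cast h2
        _ ≤ C * Real.log n := by push_cast; exact hR h1
        _ ≤ _ := mul_le_mul_of_nonneg_right (le_max_left _ _) (Real.log_natCast_nonneg n)
  · have h1 := isModes_momCreate.norm_inner_quasi_vacuum (pairAmplitude_neg μ) hψ.1 hnorm hψk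
      (δ := 1 / (2 * (n : ℝ) ^ 3)) (by positivity)
      fun k => norm_quasi_le hn hμ2
        (fun k hk => (hSapp k hk).trans_eq (by ring)) hnorm k (hann k)
    refine le_trans ?_ h1
    have h2 : 2 * ((Fintype.card (Site n) : ℝ) * (1 / (2 * (n : ℝ) ^ 3))) = 1 / n := by
      rw [Fintype.card_prod, ZMod.card]
      push_cast
      field_simp
    rw [h2]
    gcongr
    exact le_max_right _ _
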